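/- Let $q>2$, $B>0$, $t\in\mathbb R$ and $\varepsilon\in(0,1)$. There is a constant $C=C(t,B,q,\varepsilon)>0$ with the following property. Let $(\Omega,\mu)$ be any probability space (for instance a compact subset of $\mathbb R^d$ with a Borel probability measure) and let $X_N\subset L_q(\Omega,\mu)$ be a subspace of real- or complex-valued functions of dimension at most $N$, i.e. the linear span of $N$ functions of $L_q(\Omega,\mu)$. Elements of $X_N$ are specific functions (not equivalence classes), all defined on $\Omega\setminus E$ for some set $E$ with $\mu(E)=0$. Assume that for every $f\in X_N$ $$\|f\|_\infty\le t\sqrt N\,\|f\|_2\qquad\text{and}\qquad \|f\|_{4q}\le B\|f\|_2,$$ where the norms are those of $L_p(\Omega,\mu)$, $\|\cdot\|_\infty$ being the essential supremum norm. Then for every integer $m\ge1$ with $m\ge C N^{q/2}$ one has $X_N\in\mathcal M(m,q,\varepsilon)$, that is, there are points $\xi^1,\dots,\xi^m\in\Omega\setminus E$ (not necessarily distinct) such that for all $f\in X_N$ $$(1-\varepsilon)\|f\|_q^q\le\frac1m\sum_{j=1}^m|f(\xi^j)|^q\le(1+\varepsilon)\|f\|_q^q .$$ -/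

import Mathlib

open MeasureTheory
open scoped ENNReal

/-- `X` is an (at most) `N`-dimensional subspace of `L_p(Ω, μ)`: it is spanned by `N` functions and
all of its elements are in `L_p`.  The elements of `X` are specific functions, not equivalence
classes. -/
structure IsLpSubspace {Ω 𝕜 : Type*} [MeasurableSpace Ω] [RCLike 𝕜] (μ : Measure Ω)
    (p : ℝ≥0∞) (N : ℕ) (X : Submodule 𝕜 (Ω → 𝕜)) : Prop where
  exists_span : ∃ u : Fin N → (Ω → 𝕜), X = Submodule.span 𝕜 (Set.range u)
  memLp : ∀ f ∈ X, MemLp f p μ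

/-- The Nikolskii inequality for the pair `(2, ∞)` with constant `t` (Condition E):
`‖f‖_∞ ≤ t √N ‖f‖_2` for all `f ∈ X`, where `‖f‖_∞` is the essential supremum of `|f|`. -/
def NikolskiiTwoInfty {Ω 𝕜 : Type*} [MeasurableSpace Ω] [RCLike 𝕜] (μ : Measure Ω)
    (t : ℝ) (N : ℕ) (X : Submodule 𝕜 (Ω → 𝕜)) : Prop :=
  ∀ f ∈ X, eLpNorm f ∞ μ ≤ ENNReal.ofReal (t * √(N : ℝ)) * eLpNorm f 2 μ

/-- The Marcinkiewicz-type discretization theorem with parameters `m`, `q` and constants `C₁`, `C₂`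
for a space `X` of functions that are regarded as defined on `Ω \ E` (where `E` is a null set; the
values on `E` are irrelevant).  The nodes `ξ 1, …, ξ m` are points at which all functions of `X` are
defined; repetitions are allowed. -/
def MarcinkiewiczTheorem {Ω 𝕜 : Type*} [MeasurableSpace Ω] [RCLike 𝕜] (μ : Measure Ω) (E : Set Ω)
    (m : ℕ) (q C₁ C₂ : ℝ) (X : Submodule 𝕜 (Ω → 𝕜)) : Prop :=
  ∃ ξ : Fin m → Ω, (∀ j, ξ j ∉ E) ∧ ∀ f ∈ X,
    C₁ * ∫ x, ‖f x‖ ^ q ∂μ ≤ (1 / (m : ℝ)) * ∑ j, ‖f (ξ j)‖ ^ q ∧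
    (1 / (m : ℝ)) * ∑ j, ‖f (ξ j)‖ ^ q ≤ C₂ * ∫ x, ‖f x‖ ^ q ∂μ

/-- `X ∈ M(m, q, ε)`: the Marcinkiewicz-type theorem with `C₁ = 1 - ε` and `C₂ = 1 + ε`. -/
def MarcinkiewiczEps {Ω 𝕜 : Type*} [MeasurableSpace Ω] [RCLike 𝕜] (μ : Measure Ω) (E : Set Ω)
    (m : ℕ) (q ε : ℝ) (X : Submodule 𝕜 (Ω → 𝕜)) : Prop :=
  MarcinkiewiczTheorem μ E m q (1 - ε) (1 + ε) X

/-! Up to a null set, the functions of X are the marginals ω ↦ ⟨a, U ω⟩ of an isotropic random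
vector U in dimension n ≤ N (`exists_isotropic_representation`). The hypotheses turn into ‖U‖ ≤ R
with R of order √N and E|⟨a, U⟩|^(4q) ≤ (B‖a‖)^(4q). It remains to find m sample vectors v_j =
U(ξ_j) whose empirical q-th moments are close to the true ones uniformly over ‖a‖ ≤ 1.

Truncate |⟨a, ·⟩| at a constant level M. The truncated powers are bounded and Lipschitz in a, so
Hoeffding's inequality on a net of exp(O(N log N)) points controls them once m ≥ C N^(q/2), because
q > 2. The part of the integral above M is small by the 4q-th moment bound.

The crux is the part of the empirical sum above M. With probability at least 1/2 the sample is
`WeaklyCorrelated` (`measureReal_not_weaklyCorrelated_le`), and the rest is deterministic. If r of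
the numbers |⟨a, v_j⟩| are at least s, a greedy choice gives p vectors among them, p comparable to
r, whose sum has squared norm O(p(R² + pℓ_p²)). Testing this sum against a gives s² = O(R²/r +
(m/r)^(1/q)). So the r-th largest value contributes O(R^q / r^(q/2) + √(m/r)) to the q-th moment.
The first terms sum to O(R^q) = O(N^(q/2)), at most a small multiple of m; the second sum to
O(√(m·#J)), where #J = O((R^q + m)/M^q) counts the values above M
(`WeaklyCorrelated.sum_filter_rpow_le`). -/

/-- If every nonempty subset `J'` of `J` contains a point where `v` is at most `h #J'`, then the sum
of `v` over `J` is at most `h 1 + ⋯ + h #J`. -/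
lemma Finset.sum_le_sum_range_card {ι : Type*} [DecidableEq ι] (v : ι → ℝ) (h : ℕ → ℝ)
    (J : Finset ι) (H : ∀ J' ⊆ J, J'.Nonempty → ∃ j ∈ J', v j ≤ h J'.card) :
    ∑ j ∈ J, v j ≤ ∑ r ∈ Finset.range J.card, h (r + 1) := by
  induction hn : J.card generalizing J with
  | zero => simp [Finset.card_eq_zero.mp hn]
  | succ n ih =>
    have hne : J.Nonempty := Finset.card_pos.mp (by omega)
    obtain ⟨j, hj, hle⟩ := H J subset_rfl hne
    have hc : (J.erase j).card = n := by rw [Finset.card_erase_of_mem hj, hn]; rfl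
    have := ih (J.erase j) (fun J' hJ' => H J' (hJ'.trans (J.erase_subset j))) hc
    rw [Finset.sum_range_succ, ← Finset.sum_erase_add J v hj]
    rw [hn] at hle
    exact add_le_add this hle

/-! ### Deterministic tail bounds for weakly correlated vectors. -/

section Greedy

variable {𝕜 V ι : Type*} [RCLike 𝕜] [NormedAddCommGroup V] [InnerProductSpace 𝕜 V] [DecidableEq ι]

/-- A family of vectors is weakly correlated with rate `ℓ` if for disjoint sets `I`, `L` of the same
size at least one vector of `L` has a small inner product with the sum of the vectors of `I`. -/
def WeaklyCorrelated (𝕜 : Type*) {V ι : Type*} [RCLike 𝕜] [NormedAddCommGroup V]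
    [InnerProductSpace 𝕜 V] (v : ι → V) (ℓ : ℕ → ℝ) : Prop :=
  ∀ I L : Finset ι, I.Nonempty → L.card = I.card → Disjoint I L →
    ∃ k ∈ L, RCLike.re (inner 𝕜 (∑ i ∈ I, v i) (v k)) ≤ ℓ I.card * ‖∑ i ∈ I, v i‖

/-- Greedy selection: while at least as many vectors of `J` remain as were chosen, one of them is
weakly correlated with the current sum, so adding it raises the squared norm by at most R² +
2ℓ‖sum‖. -/
lemma WeaklyCorrelated.exists_subset_norm_sum_sq_le {v : ι → V} {ℓ : ℕ → ℝ}
    (hv : WeaklyCorrelated 𝕜 v ℓ) {R : ℝ} (hR : ∀ j, ‖v j‖ ≤ R)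
    (hℓ : Monotone fun p : ℕ => (p : ℝ) * ℓ p ^ 2) (p : ℕ) (hp : 1 ≤ p) (J : Finset ι)
    (hJ : 2 * p ≤ J.card + 1) :
    ∃ I ⊆ J, I.card = p ∧ ‖∑ i ∈ I, v i‖ ^ 2 ≤ 4 * p * (R ^ 2 + p * ℓ p ^ 2) := by
  induction p, hp using Nat.le_induction with
  | base =>
    obtain ⟨j, hj⟩ : J.Nonempty := Finset.card_pos.mp (by omega)
    refine ⟨{j}, by simpa using hj, by simp, ?_⟩
    have h1 : ‖v j‖ ^ 2 ≤ R ^ 2 := by gcongr; exact hR j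
    simp only [Finset.sum_singleton, Nat.cast_one]
    nlinarith [sq_nonneg (ℓ 1), sq_nonneg R]
  | succ p hp ih =>
    obtain ⟨I, hIJ, hIp, hI⟩ := ih (by omega)
    have hc : (J \ I).card = J.card - p := by rw [Finset.card_sdiff_of_subset hIJ, hIp]
    obtain ⟨L, hL, hLp⟩ := Finset.exists_subset_card_eq (show p ≤ (J \ I).card by omega)
    obtain ⟨k, hk, hkle⟩ := hv I L (Finset.card_pos.mp (by omega)) (by omega)
      (Finset.disjoint_of_subset_right hL Finset.disjoint_sdiff)
    have hkJ := hL hk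
    rw [Finset.mem_sdiff] at hkJ
    refine ⟨insert k I, Finset.insert_subset hkJ.1 hIJ, by
      rw [Finset.card_insert_of_notMem hkJ.2, hIp], ?_⟩
    rw [Finset.sum_insert hkJ.2, add_comm (v k), norm_add_sq (𝕜 := 𝕜)]
    set z := ‖∑ i ∈ I, v i‖
    have h1 : ‖v k‖ ^ 2 ≤ R ^ 2 := by gcongr; exact hR k
    have h2 : (p : ℝ) * ℓ p ^ 2 ≤ ((p + 1 : ℕ) : ℝ) * ℓ (p + 1) ^ 2 := hℓ (Nat.le_succ p)
    rw [hIp] at hkle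
    have hp0 : (0 : ℝ) < p := by exact_mod_cast hp
    -- AM-GM with weights that make the cross term cost only a 1/(2p) share of the current squared
    -- norm, which keeps the bound linear in p.
    have h3 : 2 * (ℓ p * z) ≤ z ^ 2 / (2 * p) + 2 * (p * ℓ p ^ 2) := by
      have h := sq_nonneg (z - 2 * p * ℓ p)
      have h' : z ^ 2 / (2 * p) + 2 * (p * ℓ p ^ 2) - 2 * (ℓ p * z) =
        (z - 2 * p * ℓ p) ^ 2 / (2 * p) := by field_simp; ring
      have : 0 ≤ (z - 2 * p * ℓ p) ^ 2 / (2 * p) := by positivity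
      linarith
    have h4 : z ^ 2 / (2 * p) ≤ 2 * (R ^ 2 + p * ℓ p ^ 2) := by
      rw [div_le_iff₀ (by positivity)]; linarith
    push_cast at h2 ⊢
    nlinarith [sq_nonneg R]

/-- Correlations with `a` of one sign cannot cancel: the greedy sum has norm at least p·s, against
its upper bound of order √p. -/
lemma WeaklyCorrelated.mul_sq_le_of_forall_le_re {v : ι → V} {ℓ : ℕ → ℝ}
    (hv : WeaklyCorrelated 𝕜 v ℓ) {R : ℝ} (hR : ∀ j, ‖v j‖ ≤ R)
    (hℓ : Monotone fun p : ℕ => (p : ℝ) * ℓ p ^ 2) (p : ℕ) (hp : 1 ≤ p) (J : Finset ι)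
    (hJ : 2 * p ≤ J.card + 1) {a : V} (ha : ‖a‖ ≤ 1) {s : ℝ} (hs : 0 ≤ s)
    (h : ∀ j ∈ J, s ≤ RCLike.re (inner 𝕜 a (v j))) :
    p * s ^ 2 ≤ 4 * (R ^ 2 + p * ℓ p ^ 2) := by
  obtain ⟨I, hIJ, hIp, hI⟩ := hv.exists_subset_norm_sum_sq_le hR hℓ p hp J hJ
  have h1 : p * s ≤ ‖∑ i ∈ I, v i‖ := by
    calc (p : ℝ) * s = ∑ i ∈ I, s := by simp [hIp]
      _ ≤ ∑ i ∈ I, RCLike.re (inner 𝕜 a (v i)) := Finset.sum_le_sum fun i hi => h i (hIJ hi)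
      _ = RCLike.re (inner 𝕜 a (∑ i ∈ I, v i)) := by rw [inner_sum, map_sum]
      _ ≤ ‖a‖ * ‖∑ i ∈ I, v i‖ := re_inner_le_norm _ _
      _ ≤ ‖∑ i ∈ I, v i‖ := mul_le_of_le_one_left (norm_nonneg _) ha
  have hp0 : (0 : ℝ) < p := by exact_mod_cast hp
  have h2 : (p * s) ^ 2 ≤ ‖∑ i ∈ I, v i‖ ^ 2 := by gcongr
  have h3 : p * (p * s ^ 2) ≤ p * (4 * (R ^ 2 + p * ℓ p ^ 2)) := by nlinarith
  exact le_of_mul_le_mul_left h3 hp0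

lemma WeaklyCorrelated.exists_mul_sq_le {v : ι → V} {ℓ : ℕ → ℝ}
    (hv : WeaklyCorrelated 𝕜 v ℓ) {R : ℝ} (hR : ∀ j, ‖v j‖ ≤ R)
    (hℓ : Monotone fun p : ℕ => (p : ℝ) * ℓ p ^ 2) {J : Finset ι} (hJ : J.Nonempty)
    {a : V} (ha : ‖a‖ ≤ 1) {s : ℝ} (hs : 0 ≤ s) (h : ∀ j ∈ J, s ≤ ‖inner 𝕜 a (v j)‖) :
    ∃ p : ℕ, 1 ≤ p ∧ J.card ≤ 8 * p ∧ p * s ^ 2 ≤ 16 * (R ^ 2 + p * ℓ p ^ 2) := by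
  -- Since |z| ≤ |Re z| + |Im z|, one of the four rotations by ±1, ±i has real part at least s/2;
  -- pigeonhole keeps a quarter of `J`. In the real case `RCLike.I` is 0, which does no harm.
  have key : ∃ c : 𝕜, ‖c‖ ≤ 1 ∧
      J.card ≤ 4 * (J.filter fun j => s / 2 ≤ RCLike.re (inner 𝕜 (c • a) (v j))).card := by
    have hI1 : ‖(RCLike.I : 𝕜)‖ ≤ 1 := by
      by_cases h : (RCLike.I : 𝕜) = 0
      · simp [h]
      · exact (RCLike.norm_I_of_ne_zero h).le
    by_contra! hcon
    have h1 := hcon 1 (by simp)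
    have h2 := hcon (-1) (by simp)
    have h3 := hcon RCLike.I hI1
    have h4 := hcon (-RCLike.I) (by simpa using hI1)
    have hsub : J ⊆ ((J.filter fun j => s / 2 ≤ RCLike.re (inner 𝕜 ((1 : 𝕜) • a) (v j))) ∪
        (J.filter fun j => s / 2 ≤ RCLike.re (inner 𝕜 ((-1 : 𝕜) • a) (v j)))) ∪
        ((J.filter fun j => s / 2 ≤ RCLike.re (inner 𝕜 ((RCLike.I : 𝕜) • a) (v j))) ∪
        (J.filter fun j => s / 2 ≤ RCLike.re (inner 𝕜 ((-RCLike.I : 𝕜) • a) (v j)))) := by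
      intro j hj
      have hz := h j hj
      set z := inner 𝕜 a (v j)
      have hn : ‖z‖ ≤ |RCLike.re z| + |RCLike.im z| := by
        conv_lhs => rw [← RCLike.re_add_im z]
        refine (norm_add_le _ _).trans ?_
        rw [norm_mul, RCLike.norm_ofReal, RCLike.norm_ofReal]
        gcongr
        exact mul_le_of_le_one_right (abs_nonneg _) hI1
      have hI : RCLike.re (inner 𝕜 ((RCLike.I : 𝕜) • a) (v j)) = RCLike.im z := by
        rw [inner_smul_left]; simp [z]
      have hI' : RCLike.re (inner 𝕜 ((-RCLike.I : 𝕜) • a) (v j)) = -RCLike.im z := by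
        rw [neg_smul, inner_neg_left, map_neg, hI]
      have h1' : RCLike.re (inner 𝕜 ((1 : 𝕜) • a) (v j)) = RCLike.re z := by simp [z]
      have h2' : RCLike.re (inner 𝕜 ((-1 : 𝕜) • a) (v j)) = -RCLike.re z := by
        rw [neg_smul, inner_neg_left, map_neg, h1']
      simp only [Finset.mem_union, Finset.mem_filter, hj, true_and, hI, hI', h1', h2']
      by_contra! hc
      obtain ⟨⟨c1, c2⟩, c3, c4⟩ := hc
      have := abs_lt.mpr ⟨by linarith, c1⟩
      have := abs_lt.mpr ⟨by linarith, c3⟩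
      linarith
    have hcard := (Finset.card_le_card hsub).trans (Finset.card_union_le _ _)
    have e1 := Finset.card_union_le
      (J.filter fun j => s / 2 ≤ RCLike.re (inner 𝕜 ((1 : 𝕜) • a) (v j)))
      (J.filter fun j => s / 2 ≤ RCLike.re (inner 𝕜 ((-1 : 𝕜) • a) (v j)))
    have e2 := Finset.card_union_le
      (J.filter fun j => s / 2 ≤ RCLike.re (inner 𝕜 ((RCLike.I : 𝕜) • a) (v j)))
      (J.filter fun j => s / 2 ≤ RCLike.re (inner 𝕜 ((-RCLike.I : 𝕜) • a) (v j)))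
    omega
  obtain ⟨c, hc, hcard⟩ := key
  set J' := J.filter fun j => s / 2 ≤ RCLike.re (inner 𝕜 (c • a) (v j))
  have hJ0 := Finset.card_pos.mpr hJ
  -- The largest p the greedy selection allows; it is at least #J/8.
  refine ⟨(J'.card + 1) / 2, by omega, by omega, ?_⟩
  have := hv.mul_sq_le_of_forall_le_re hR hℓ ((J'.card + 1) / 2) (by omega) J' (by omega)
    (a := c • a) (by rw [norm_smul]; exact mul_le_one₀ hc (norm_nonneg _) ha) (by positivity)
    (fun j hj => (Finset.mem_filter.mp hj).2)
  nlinarith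

/-- The rate of correlation that `m` independent vectors satisfy. -/
noncomputable def correlationRate (b q : ℝ) (m p : ℕ) : ℝ := b * ((m : ℝ) / p) ^ (1 / (2 * q))

lemma correlationRate_sq {b q : ℝ} (m p : ℕ) :
    correlationRate b q m p ^ 2 = b ^ 2 * ((m : ℝ) / p) ^ (1 / q) := by
  rw [correlationRate, mul_pow, ← Real.rpow_natCast (_ ^ _), ← Real.rpow_mul (by positivity)]
  congr 2
  push_cast
  rw [one_div, one_div, mul_inv]
  ring

lemma monotone_mul_correlationRate_sq {b q : ℝ} (hq : 2 < q) (m : ℕ) :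
    Monotone fun p : ℕ => (p : ℝ) * correlationRate b q m p ^ 2 := by
  have hq1 : 1 / q ≤ 1 := by rw [div_le_one (by linarith)]; linarith
  have key : ∀ p : ℕ, (p : ℝ) * correlationRate b q m p ^ 2 =
      b ^ 2 * (m : ℝ) ^ (1 / q) * if p = 0 then 0 else (p : ℝ) ^ (1 - 1 / q) := by
    intro p
    rcases Nat.eq_zero_or_pos p with rfl | hp
    · simp
    have hp0 : (0 : ℝ) < p := by exact_mod_cast hp
    rw [correlationRate_sq, if_neg hp.ne', Real.div_rpow (by positivity) (by positivity),
      Real.rpow_sub hp0, Real.rpow_one]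
    ring
  intro p p' hpp
  simp only [key]
  gcongr
  split_ifs with h1 h2 h2
  · rfl
  · positivity
  · omega
  · gcongr

/-- Applied to the set of the r largest values, this bounds the r-th one. The exponent 1/(2q) of the
rate becomes the square root of m/r after taking q-th powers. -/
lemma WeaklyCorrelated.rpow_le {v : ι → V} {b q : ℝ} {m : ℕ} (hq : 2 < q) (hb : 0 ≤ b)
    (hv : WeaklyCorrelated 𝕜 v (correlationRate b q m)) {R : ℝ} (hR0 : 0 ≤ R)
    (hR : ∀ j, ‖v j‖ ≤ R) {J : Finset ι} (hJ : J.Nonempty)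
    {a : V} (ha : ‖a‖ ≤ 1) {s : ℝ} (hs : 0 ≤ s) (h : ∀ j ∈ J, s ≤ ‖inner 𝕜 a (v j)‖) :
    s ^ q ≤ 256 ^ (q / 2) * (R ^ q / (J.card : ℝ) ^ (q / 2) + b ^ q * √((m : ℝ) / J.card)) := by
  obtain ⟨p, hp, hJp, hle⟩ := hv.exists_mul_sq_le hR (monotone_mul_correlationRate_sq hq m) hJ ha
    hs h
  have hp0 : (0 : ℝ) < p := by exact_mod_cast hp
  have hq0 : 0 < q := by linarith
  have hr0 : (0 : ℝ) < J.card := by exact_mod_cast Finset.card_pos.mpr hJ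
  have hJp' : (J.card : ℝ) ≤ 8 * p := by exact_mod_cast hJp
  set r : ℝ := (J.card : ℝ)
  have hinv : 1 / (p : ℝ) ≤ 8 / r := by
    rw [div_le_div_iff₀ hp0 hr0]; linarith
  have h1 : s ^ 2 ≤ 16 * (R ^ 2 * (1 / p) + correlationRate b q m p ^ 2) := by
    have : p * s ^ 2 ≤ p * (16 * (R ^ 2 * (1 / p) + correlationRate b q m p ^ 2)) := by
      refine hle.trans (le_of_eq ?_); field_simp
    exact le_of_mul_le_mul_left this hp0
  have h2 : correlationRate b q m p ^ 2 ≤ 8 * (b ^ 2 * ((m : ℝ) / r) ^ (1 / q)) := by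
    rw [correlationRate_sq]
    have e : ((m : ℝ) / p) ^ (1 / q) ≤ 8 * ((m : ℝ) / r) ^ (1 / q) := by
      calc ((m : ℝ) / p) ^ (1 / q) ≤ (8 * ((m : ℝ) / r)) ^ (1 / q) := by
            gcongr
            calc (m : ℝ) / p = m * (1 / p) := by ring
              _ ≤ m * (8 / r) := by gcongr
              _ = _ := by ring
        _ = 8 ^ (1 / q) * ((m : ℝ) / r) ^ (1 / q) := Real.mul_rpow (by norm_num) (by positivity)
        _ ≤ 8 * ((m : ℝ) / r) ^ (1 / q) := by
            gcongr
            calc (8 : ℝ) ^ (1 / q) ≤ 8 ^ (1 : ℝ) := by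
                  gcongr
                  · norm_num
                  · rw [div_le_one hq0]; linarith
              _ = 8 := Real.rpow_one _
    nlinarith [sq_nonneg b]
  set x := R ^ 2 / r
  set y := b ^ 2 * ((m : ℝ) / r) ^ (1 / q)
  have hx : 0 ≤ x := by positivity
  have hy : 0 ≤ y := by positivity
  have h3 : s ^ 2 ≤ 256 * max x y := by
    have : R ^ 2 * (1 / p) ≤ 8 * x := by
      calc R ^ 2 * (1 / p) ≤ R ^ 2 * (8 / r) := by gcongr
        _ = 8 * x := by ring
    have := le_max_left x y
    have := le_max_right x y
    linarith
  have h4 : s ^ q = (s ^ 2) ^ (q / 2) := by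
    rw [← Real.rpow_natCast, ← Real.rpow_mul hs]; congr 1; push_cast; ring
  have hxq : x ^ (q / 2) = R ^ q / r ^ (q / 2) := by
    rw [Real.div_rpow (by positivity) hr0.le, ← Real.rpow_natCast, ← Real.rpow_mul hR0]
    congr 2; push_cast; ring
  have hyq : y ^ (q / 2) = b ^ q * √((m : ℝ) / r) := by
    rw [Real.mul_rpow (by positivity) (by positivity), ← Real.rpow_natCast, ← Real.rpow_mul hb,
      ← Real.rpow_mul (by positivity), Real.sqrt_eq_rpow]
    congr 2
    · push_cast; ring
    · field_simp
  rw [h4, ← hxq, ← hyq]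
  calc (s ^ 2) ^ (q / 2) ≤ (256 * max x y) ^ (q / 2) := by gcongr
    _ = 256 ^ (q / 2) * (max x y) ^ (q / 2) := Real.mul_rpow (by norm_num) (le_max_of_le_left hx)
    _ ≤ 256 ^ (q / 2) * (x ^ (q / 2) + y ^ (q / 2)) := by
      gcongr
      have hx' : 0 ≤ x ^ (q / 2) := by positivity
      have hy' : 0 ≤ y ^ (q / 2) := by positivity
      rcases max_choice x y with h | h <;> rw [h] <;> linarith

lemma sum_range_inv_sqrt_le (n : ℕ) :
    ∑ r ∈ Finset.range n, 1 / √((r + 1 : ℕ) : ℝ) ≤ 2 * √(n : ℝ) := by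
  induction n with
  | zero => simp
  | succ n ih =>
    rw [Finset.sum_range_succ]
    have h0 : (0 : ℝ) < √((n + 1 : ℕ) : ℝ) := Real.sqrt_pos.mpr (by positivity)
    have h1 : √((n + 1 : ℕ) : ℝ) ^ 2 = n + 1 := by rw [Real.sq_sqrt (by positivity)]; push_cast; rfl
    have h2 : √(n : ℝ) ^ 2 = n := Real.sq_sqrt (by positivity)
    have h3 : 1 / √((n + 1 : ℕ) : ℝ) ≤ 2 * √((n + 1 : ℕ) : ℝ) - 2 * √(n : ℝ) := by
      rw [div_le_iff₀ h0]
      nlinarith [sq_nonneg (√((n + 1 : ℕ) : ℝ) - √(n : ℝ))]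
    linarith

/-- The contribution of the large values `|⟨a, v j⟩| > M` to the `q`-th moment. -/
lemma WeaklyCorrelated.sum_filter_rpow_le [Fintype ι] {v : ι → V} {b q : ℝ} (hq : 2 < q)
    (hb : 0 ≤ b) (hv : WeaklyCorrelated 𝕜 v (correlationRate b q (Fintype.card ι))) {R : ℝ}
    (hR0 : 0 ≤ R) (hR : ∀ j, ‖v j‖ ≤ R) {a : V} (ha : ‖a‖ ≤ 1) {M : ℝ} (hM : 0 < M) :
    ∑ j with M < ‖inner 𝕜 a (v j)‖, ‖inner 𝕜 a (v j)‖ ^ q ≤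
      256 ^ (q / 2) * (R ^ q * ∑' r : ℕ, 1 / ((r + 1 : ℕ) : ℝ) ^ (q / 2) +
        2 * b ^ q * √(Fintype.card ι *
          (256 ^ (q / 2) * (R ^ q + b ^ q * Fintype.card ι) / M ^ q))) := by
  set m := Fintype.card ι
  set J := Finset.univ.filter fun j => M < ‖inner 𝕜 a (v j)‖
  set A : ℝ := 256 ^ (q / 2)
  have hA : 0 < A := by positivity
  -- In every subset the smallest value obeys the bound for that cardinality, so peeling off the
  -- smallest values one by one sums the bounds over r.
  have hsum := Finset.sum_le_sum_range_card (fun j => ‖inner 𝕜 a (v j)‖ ^ q)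
    (fun r => A * (R ^ q / (r : ℝ) ^ (q / 2) + b ^ q * √((m : ℝ) / r))) J (by
      intro J' _ hne
      obtain ⟨j, hj, hmin⟩ := Finset.exists_min_image J' (fun j => ‖inner 𝕜 a (v j)‖) hne
      exact ⟨j, hj, hv.rpow_le hq hb hR0 hR hne ha (norm_nonneg _) hmin⟩)
  -- The same bound with s = M limits how many values can exceed M.
  have hcard : (J.card : ℝ) ≤ A * (R ^ q + b ^ q * m) / M ^ q := by
    rcases J.eq_empty_or_nonempty with h | h
    · rw [h]; simp only [Finset.card_empty, Nat.cast_zero]; positivity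
    have h1 := hv.rpow_le hq hb hR0 hR h ha hM.le
      (fun j hj => (Finset.mem_filter.mp hj).2.le)
    have hr1 : (1 : ℝ) ≤ J.card := by exact_mod_cast Finset.card_pos.mpr h
    have hrm : (J.card : ℝ) ≤ m := by exact_mod_cast Finset.card_le_univ J
    set r : ℝ := (J.card : ℝ)
    have hr0 : 0 < r := by linarith
    have h2 : r ≤ r ^ (q / 2) := by
      calc r = r ^ (1 : ℝ) := (Real.rpow_one _).symm
        _ ≤ r ^ (q / 2) := Real.rpow_le_rpow_of_exponent_le hr1 (by linarith)
    have h3 : √((m : ℝ) / r) ≤ m / r := by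
      rw [Real.sqrt_le_left (by positivity)]
      have : 1 ≤ (m : ℝ) / r := by rwa [le_div_iff₀ hr0, one_mul]
      nlinarith
    rw [le_div_iff₀ (by positivity)]
    calc r * M ^ q ≤ r * (A * (R ^ q / r ^ (q / 2) + b ^ q * √((m : ℝ) / r))) := by gcongr
      _ ≤ r * (A * (R ^ q / r + b ^ q * ((m : ℝ) / r))) := by gcongr
      _ = A * (R ^ q + b ^ q * m) := by field_simp
  refine hsum.trans ?_
  -- Here q > 2 is essential: the exponent q/2 exceeds 1.
  have hsummable : Summable fun r : ℕ => 1 / ((r + 1 : ℕ) : ℝ) ^ (q / 2) :=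
    (summable_nat_add_iff 1).mpr (Real.summable_one_div_nat_rpow.mpr (by linarith))
  calc ∑ r ∈ Finset.range J.card,
        A * (R ^ q / ((r + 1 : ℕ) : ℝ) ^ (q / 2) + b ^ q * √((m : ℝ) / (r + 1 : ℕ)))
      = A * (R ^ q * ∑ r ∈ Finset.range J.card, 1 / ((r + 1 : ℕ) : ℝ) ^ (q / 2) +
          b ^ q * √(m : ℝ) * ∑ r ∈ Finset.range J.card, 1 / √((r + 1 : ℕ) : ℝ)) := by
        rw [← Finset.mul_sum, Finset.sum_add_distrib, Finset.mul_sum, Finset.mul_sum]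
        congr 2
        · exact Finset.sum_congr rfl fun r _ => by ring
        · exact Finset.sum_congr rfl fun r _ => by
            rw [Real.sqrt_div (by positivity)]; ring
    _ ≤ A * (R ^ q * ∑' r : ℕ, 1 / ((r + 1 : ℕ) : ℝ) ^ (q / 2) +
          b ^ q * √(m : ℝ) * (2 * √(J.card : ℝ))) := by
        gcongr
        · exact hsummable.sum_le_tsum _ fun r _ => by positivity
        · exact sum_range_inv_sqrt_le _
    _ = A * (R ^ q * ∑' r : ℕ, 1 / ((r + 1 : ℕ) : ℝ) ^ (q / 2) +
          2 * b ^ q * √(m * J.card)) := by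
        rw [Real.sqrt_mul (by positivity)]; ring
    _ ≤ _ := by gcongr

end Greedy

/-! ### Independent samples: conditional product bounds and Hoeffding's inequality. -/

section ProductMeasure

variable {Ω ι : Type*} [MeasurableSpace Ω] [Fintype ι]

/-- If the condition `P x` on a point depends only on the coordinates of `x` outside `L` and has
probability at most `c`, then all the coordinates in `L` satisfy it with probability at most
`c ^ #L`. -/
lemma measure_pi_forall_mem_le [DecidableEq ι] (μ : Measure Ω) [IsProbabilityMeasure μ] (L : Finset ι)
    (P : (ι → Ω) → Ω → Prop) (hP : ∀ x y, (∀ i ∉ L, x i = y i) → P x = P y) (c : ℝ≥0∞)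
    (hc : ∀ x, μ {ω | P x ω} ≤ c) (hmeas : MeasurableSet {x : ι → Ω | ∀ k ∈ L, P x (x k)}) :
    Measure.pi (fun _ : ι => μ) {x | ∀ k ∈ L, P x (x k)} ≤ c ^ L.card := by
  have : Nonempty Ω := nonempty_of_isProbabilityMeasure μ
  let x₀ : ι → Ω := fun _ => Classical.arbitrary Ω
  set A := {x : ι → Ω | ∀ k ∈ L, P x (x k)}
  have hf : Measurable (A.indicator (1 : (ι → Ω) → ℝ≥0∞)) := measurable_one.indicator hmeas
  -- With the coordinates outside `L` frozen, P is a fixed condition and those in `L` satisfy it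
  -- independently.
  have h1 : lmarginal (fun _ => μ) L (A.indicator 1) ≤ fun _ => c ^ L.card := by
    intro x
    have hsub : ∀ y : L → Ω, A.indicator (1 : (ι → Ω) → ℝ≥0∞) (Function.updateFinset x L y) ≤
        (Set.univ.pi fun _ : L => {ω | P x ω}).indicator 1 y := by
      intro y
      by_cases hy : Function.updateFinset x L y ∈ A
      · have : y ∈ Set.univ.pi fun _ : L => {ω | P x ω} := by
          intro k _
          have h := hy k k.2
          rw [hP _ x (fun i hi => by simp [Function.updateFinset, hi])] at h
          simpa [Function.updateFinset] using h
        simp [hy, Set.indicator_of_mem this]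
      · simp [hy]
    calc ∫⁻ y, A.indicator 1 (Function.updateFinset x L y) ∂Measure.pi (fun _ : L => μ)
        ≤ ∫⁻ y, (Set.univ.pi fun _ : L => {ω | P x ω}).indicator 1 y
            ∂Measure.pi (fun _ : L => μ) := lintegral_mono hsub
      _ ≤ Measure.pi (fun _ : L => μ) (Set.univ.pi fun _ : L => {ω | P x ω}) :=
          lintegral_indicator_one_le _
      _ = ∏ _k : L, μ {ω | P x ω} := Measure.pi_pi _ _
      _ ≤ ∏ _k : L, c := Finset.prod_le_prod' fun _ _ => hc x
      _ = c ^ L.card := by simp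
  rw [← lintegral_indicator_one hmeas, lintegral_eq_lmarginal_univ x₀,
    show (Finset.univ : Finset ι) = Lᶜ ∪ L by rw [Finset.union_comm, Finset.union_compl],
    lmarginal_union _ _ hf disjoint_compl_left]
  refine (lmarginal_mono h1 x₀).trans ?_
  simp [lmarginal]

/-- Hoeffding's inequality for averages over independent samples. -/
lemma measureReal_pi_abs_average_sub_ge_le (μ : Measure Ω) [IsProbabilityMeasure μ] {g : Ω → ℝ}
    (hg : Measurable g) {T : ℝ} (hT : 0 < T) (hgT : ∀ ω, g ω ∈ Set.Icc 0 T) {δ : ℝ} (hδ : 0 ≤ δ)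
    (hι : 0 < Fintype.card ι) :
    (Measure.pi fun _ : ι => μ).real
        {x | δ ≤ |1 / (Fintype.card ι : ℝ) * ∑ j, g (x j) - ∫ ω, g ω ∂μ|} ≤
      2 * Real.exp (-(2 * δ ^ 2 / T ^ 2 * Fintype.card ι)) := by
  set m := Fintype.card ι
  have hm : (0 : ℝ) < m := by exact_mod_cast hι
  set e := ∫ ω, g ω ∂μ
  have hsub : ProbabilityTheory.HasSubgaussianMGF (fun ω => g ω - e) ((‖T - 0‖₊ / 2) ^ 2) μ :=
    ProbabilityTheory.hasSubgaussianMGF_of_mem_Icc hg.aemeasurable (ae_of_all _ hgT)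
  have one_sided : ∀ h : Ω → ℝ, Measurable h →
      ProbabilityTheory.HasSubgaussianMGF h ((‖T - 0‖₊ / 2) ^ 2) μ →
      (Measure.pi fun _ : ι => μ).real {x | m * δ ≤ ∑ j, h (x j)} ≤
        Real.exp (-(2 * δ ^ 2 / T ^ 2 * m)) := by
    intro h hh hs
    have hind : ProbabilityTheory.iIndepFun (fun (i : ι) (x : ι → Ω) => h (x i))
        (Measure.pi fun _ : ι => μ) :=
      ProbabilityTheory.iIndepFun_pi fun _ => hh.aemeasurable
    have hs' : ∀ i ∈ (Finset.univ : Finset ι), ProbabilityTheory.HasSubgaussianMGF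
        (fun x : ι → Ω => h (x i)) ((‖T - 0‖₊ / 2) ^ 2) (Measure.pi fun _ : ι => μ) := by
      intro i _
      refine ProbabilityTheory.HasSubgaussianMGF.of_map (Y := fun x : ι → Ω => x i) (X := h)
        (measurable_pi_apply i).aemeasurable ?_
      rwa [(measurePreserving_eval (fun _ : ι => μ) i).map_eq]
    refine (ProbabilityTheory.HasSubgaussianMGF.measure_sum_ge_le_of_iIndepFun hind hs'
      (by positivity)).trans (le_of_eq ?_)
    congr 1
    simp only [sub_zero, Finset.sum_const, Finset.card_univ, nsmul_eq_mul]
    push_cast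
    rw [Real.norm_of_nonneg hT.le]
    change -(m * δ) ^ 2 / (2 * (m * (T / 2) ^ 2)) = _
    field_simp
  have h1 := one_sided _ (hg.sub_const e) hsub
  have h2 := one_sided _ (hg.sub_const e).neg hsub.neg
  have hcover : {x : ι → Ω | δ ≤ |1 / (m : ℝ) * ∑ j, g (x j) - e|} ⊆
      {x | m * δ ≤ ∑ j, (g (x j) - e)} ∪ {x | m * δ ≤ ∑ j, (-fun ω => g ω - e) (x j)} := by
    intro x hx
    have hx' : m * δ ≤ |∑ j, (g (x j) - e)| := by
      have : ∑ j, (g (x j) - e) = m * (1 / (m : ℝ) * ∑ j, g (x j) - e) := by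
        rw [Finset.sum_sub_distrib]
        simp only [Finset.sum_const, Finset.card_univ, nsmul_eq_mul]
        change ∑ j, g (x j) - (m : ℝ) * e = _
        field_simp
      rw [this, abs_mul, abs_of_pos hm]
      exact mul_le_mul_of_nonneg_left hx hm.le
    simp only [Set.mem_union, Set.mem_ofPred_eq, Pi.neg_apply, Finset.sum_neg_distrib]
    exact le_abs.mp hx'
  refine (measureReal_mono hcover).trans ((measureReal_union_le _ _).trans ?_)
  linarith

end ProductMeasure

/-! ### Weak correlation of a random sample. -/

section Correlation

variable {Ω 𝕜 V ι : Type*} [MeasurableSpace Ω] [RCLike 𝕜] [NormedAddCommGroup V]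
  [InnerProductSpace 𝕜 V] [Fintype ι] [DecidableEq ι]

/-- Markov's inequality for the 4q-th moment. The rate's exponent 1/(2q) gives exactly the power
(m/p)², and 256 = 2^8 ≤ 2^(4q). -/
lemma measureReal_lt_re_inner_le {μ : Measure Ω} [IsProbabilityMeasure μ] {U : Ω → V}
    (hU : StronglyMeasurable U) {R : ℝ} (hR : ∀ ω, ‖U ω‖ ≤ R) {B q : ℝ} (hB : 0 < B) (hq : 2 < q)
    (hmom : ∀ a, ∫ ω, ‖inner 𝕜 a (U ω)‖ ^ (4 * q) ∂μ ≤ (B * ‖a‖) ^ (4 * q)) {m p : ℕ}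
    (hm : 0 < m) (hp : 0 < p) (y : V) :
    μ.real {ω | correlationRate (2 * B) q m p * ‖y‖ < RCLike.re (inner 𝕜 y (U ω))} ≤
      ((p : ℝ) / m) ^ 2 / 256 := by
  have hm0 : (0 : ℝ) < m := by exact_mod_cast hm
  have hp0 : (0 : ℝ) < p := by exact_mod_cast hp
  rcases eq_or_ne y 0 with rfl | hy
  · simp; positivity
  have hy0 : 0 < ‖y‖ := norm_pos_iff.mpr hy
  set l := correlationRate (2 * B) q m p
  have hl : 0 < l := by unfold l correlationRate; positivity
  have hint : Integrable (fun ω => ‖inner 𝕜 y (U ω)‖ ^ (4 * q)) μ := by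
    refine Integrable.of_mem_Icc 0 ((‖y‖ * R) ^ (4 * q))
      (((stronglyMeasurable_const.inner hU).norm.measurable.pow_const _).aemeasurable)
      (ae_of_all _ fun ω => ⟨by positivity, ?_⟩)
    gcongr
    exact (norm_inner_le_norm _ _).trans (by gcongr; exact hR ω)
  have hmarkov := mul_meas_ge_le_integral_of_nonneg (ae_of_all μ fun ω => by positivity) hint
    ((l * ‖y‖) ^ (4 * q))
  have hsub : {ω | l * ‖y‖ < RCLike.re (inner 𝕜 y (U ω))} ⊆
      {ω | (l * ‖y‖) ^ (4 * q) ≤ ‖inner 𝕜 y (U ω)‖ ^ (4 * q)} := by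
    intro ω hω
    simp only [Set.mem_ofPred_eq] at hω ⊢
    gcongr
    exact hω.le.trans (RCLike.re_le_norm _)
  have hpow : (l * ‖y‖) ^ (4 * q) = 2 ^ (4 * q) * (B * ‖y‖) ^ (4 * q) * ((m : ℝ) / p) ^ 2 := by
    unfold l correlationRate
    rw [show 2 * B * ((m : ℝ) / p) ^ (1 / (2 * q)) * ‖y‖ =
      2 * (B * ‖y‖) * ((m : ℝ) / p) ^ (1 / (2 * q)) by ring, Real.mul_rpow (by positivity)
      (by positivity), Real.mul_rpow (by positivity) (by positivity),
      ← Real.rpow_mul (by positivity), ← Real.rpow_natCast]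
    congr 2
    push_cast
    field_simp
    norm_num
  have h256 : (256 : ℝ) ≤ 2 ^ (4 * q) := by
    calc (256 : ℝ) = 2 ^ (8 : ℝ) := by norm_num
      _ ≤ 2 ^ (4 * q) := Real.rpow_le_rpow_of_exponent_le (by norm_num) (by linarith)
  have h0 : 0 < (B * ‖y‖) ^ (4 * q) := by positivity
  set r := μ.real {ω | (l * ‖y‖) ^ (4 * q) ≤ ‖inner 𝕜 y (U ω)‖ ^ (4 * q)}
  have hr : 0 ≤ r := measureReal_nonneg
  refine (measureReal_mono hsub).trans ?_
  change r ≤ _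
  have h1 := hmarkov.trans (hmom y)
  rw [hpow] at h1
  have h2 : 2 ^ (4 * q) * ((m : ℝ) / p) ^ 2 * r ≤ 1 := by
    refine le_of_mul_le_mul_left ?_ h0
    linarith
  have h3 : 256 * ((m : ℝ) / p) ^ 2 * r ≤ 1 := le_trans (by gcongr) h2
  have h4 : ((p : ℝ) / m) ^ 2 / 256 * (256 * ((m : ℝ) / p) ^ 2) = 1 := by field_simp
  calc r = ((p : ℝ) / m) ^ 2 / 256 * (256 * ((m : ℝ) / p) ^ 2 * r) := by
        rw [← mul_assoc, h4, one_mul]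
    _ ≤ ((p : ℝ) / m) ^ 2 / 256 * 1 := by gcongr
    _ = _ := mul_one _

lemma choose_mul_div_pow_le {m : ℕ} (hm : 0 < m) (p : ℕ) :
    (m.choose p : ℝ) * ((p : ℝ) / m) ^ p ≤ Real.exp 1 ^ p := by
  have hm0 : (0 : ℝ) < m := by exact_mod_cast hm
  calc (m.choose p : ℝ) * ((p : ℝ) / m) ^ p
      ≤ (m : ℝ) ^ p / p.factorial * ((p : ℝ) / m) ^ p := by
        gcongr
        exact Nat.choose_le_pow_div p m
    _ = (p : ℝ) ^ p / p.factorial := by rw [div_pow]; field_simp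
    _ ≤ Real.exp p := Real.pow_div_factorial_le_exp _ (by positivity) p
    _ = Real.exp 1 ^ p := by rw [← Real.exp_nat_mul]; simp

/-- Independent random vectors are weakly correlated with probability at least `1 / 2`. -/
lemma measureReal_not_weaklyCorrelated_le {μ : Measure Ω} [IsProbabilityMeasure μ] {U : Ω → V}
    (hU : StronglyMeasurable U) {R : ℝ} (hR : ∀ ω, ‖U ω‖ ≤ R) {B q : ℝ} (hB : 0 < B) (hq : 2 < q)
    (hmom : ∀ a, ∫ ω, ‖inner 𝕜 a (U ω)‖ ^ (4 * q) ∂μ ≤ (B * ‖a‖) ^ (4 * q)) :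
    (Measure.pi fun _ : ι => μ).real
      {x | ¬ WeaklyCorrelated 𝕜 (fun i => U (x i))
        (correlationRate (2 * B) q (Fintype.card ι))} ≤ 1 / 2 := by
  set m := Fintype.card ι
  let S : Finset ι → Finset ι → Set (ι → Ω) := fun I L =>
    {x | Disjoint I L ∧ ∀ k ∈ L, correlationRate (2 * B) q m I.card * ‖∑ i ∈ I, U (x i)‖ <
      RCLike.re (inner 𝕜 (∑ i ∈ I, U (x i)) (U (x k)))}
  have hcover : {x : ι → Ω | ¬ WeaklyCorrelated 𝕜 (fun i => U (x i))
        (correlationRate (2 * B) q m)} ⊆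
      ⋃ r ∈ Finset.range m, ⋃ I ∈ Finset.univ.powersetCard (r + 1),
        ⋃ L ∈ Finset.univ.powersetCard (r + 1), S I L := by
    intro x hx
    simp only [Set.mem_ofPred_eq, WeaklyCorrelated] at hx
    push Not at hx
    obtain ⟨I, L, hI, hL, hIL, hk⟩ := hx
    have hI0 := Finset.card_pos.mpr hI
    have hIm : I.card ≤ m := Finset.card_le_univ I
    simp only [Set.mem_iUnion, Finset.mem_powersetCard, Finset.subset_univ, true_and,
      Finset.mem_range, exists_prop]
    exact ⟨I.card - 1, by omega, I, by omega, L, by omega, hIL, hk⟩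
  have hS : ∀ r, r < m → ∀ I L : Finset ι, I.card = r + 1 → L.card = r + 1 →
      (Measure.pi fun _ : ι => μ).real (S I L) ≤
        ((((r + 1 : ℕ) : ℝ) / m) ^ 2 / 256) ^ (r + 1) := by
    intro r hr I L hI hL
    by_cases hIL : Disjoint I L
    swap
    · simp only [S, hIL, false_and, Set.ofPred_false, measureReal_empty]
      positivity
    simp only [S, hIL, true_and]
    have hUi : ∀ i : ι, StronglyMeasurable fun x : ι → Ω => U (x i) := fun i =>
      hU.comp_measurable (measurable_pi_apply i)
    have hsum : StronglyMeasurable fun x : ι → Ω => ∑ i ∈ I, U (x i) :=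
      Finset.stronglyMeasurable_fun_sum _ fun i _ => hUi i
    have hmeas : MeasurableSet {x : ι → Ω | ∀ k ∈ L,
        correlationRate (2 * B) q m I.card * ‖∑ i ∈ I, U (x i)‖ <
          RCLike.re (inner 𝕜 (∑ i ∈ I, U (x i)) (U (x k)))} := by
      simp only [Set.ofPred_forall]
      refine MeasurableSet.iInter fun k => MeasurableSet.iInter fun _ => measurableSet_lt ?_ ?_
      · exact hsum.norm.measurable.const_mul _
      · exact (RCLike.continuous_re.comp_stronglyMeasurable (hsum.inner (hUi k))).measurable
    have h := measure_pi_forall_mem_le μ L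
      (fun x ω => correlationRate (2 * B) q m I.card * ‖∑ i ∈ I, U (x i)‖ <
          RCLike.re (inner 𝕜 (∑ i ∈ I, U (x i)) (U ω)))
      (by
        intro x y hxy
        have : ∑ i ∈ I, U (x i) = ∑ i ∈ I, U (y i) := Finset.sum_congr rfl fun i hi => by
          rw [hxy i (Finset.disjoint_left.mp hIL hi)]
        simp only [this])
      (ENNReal.ofReal ((((r + 1 : ℕ) : ℝ) / m) ^ 2 / 256))
      (by
        intro x
        have := measureReal_lt_re_inner_le hU hR hB hq hmom (m := m) (p := I.card) (by omega)
          (by omega) (∑ i ∈ I, U (x i))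
        rw [← ofReal_measureReal]
        apply ENNReal.ofReal_le_ofReal
        rw [hI] at this ⊢
        exact this)
      hmeas
    rw [measureReal_def]
    refine ENNReal.toReal_le_of_le_ofReal (by positivity) ?_
    rw [hL, ← ENNReal.ofReal_pow (by positivity)] at h
    exact h
  have hexp : Real.exp 1 ^ 2 / 256 ≤ 1 / 4 := by
    nlinarith [Real.exp_one_lt_d9, Real.exp_pos 1]
  have hterm : ∀ r ∈ Finset.range m, (Measure.pi fun _ : ι => μ).real
      (⋃ I ∈ Finset.univ.powersetCard (r + 1), ⋃ L ∈ Finset.univ.powersetCard (r + 1), S I L) ≤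
        (1 / 4) ^ (r + 1) := by
    intro r hr
    have hr' := Finset.mem_range.mp hr
    calc _ ≤ ∑ I ∈ Finset.univ.powersetCard (r + 1), ∑ L ∈ Finset.univ.powersetCard (r + 1),
          (Measure.pi fun _ : ι => μ).real (S I L) := by
          refine (measureReal_biUnion_finset_le _ _).trans (Finset.sum_le_sum fun I _ => ?_)
          exact measureReal_biUnion_finset_le _ _
      _ ≤ ∑ I ∈ (Finset.univ : Finset ι).powersetCard (r + 1),
          ∑ L ∈ (Finset.univ : Finset ι).powersetCard (r + 1),
          ((((r + 1 : ℕ) : ℝ) / m) ^ 2 / 256) ^ (r + 1) :=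
          Finset.sum_le_sum fun I hI => Finset.sum_le_sum fun L hL =>
            hS r hr' I L (Finset.mem_powersetCard.mp hI).2 (Finset.mem_powersetCard.mp hL).2
      -- The choices of I and of L cost two binomial coefficients; the square of p/m absorbs one
      -- factor each, which is why the moment of order 4q is assumed.
      _ = ((m.choose (r + 1) : ℝ) * (((r + 1 : ℕ) : ℝ) / m) ^ (r + 1)) ^ 2
            / 256 ^ (r + 1) := by
          simp only [Finset.sum_const, Finset.card_powersetCard, Finset.card_univ, nsmul_eq_mul]
          rw [div_pow, ← pow_mul, mul_comm 2, pow_mul]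
          ring
      _ ≤ (Real.exp 1 ^ (r + 1)) ^ 2 / 256 ^ (r + 1) := by
          gcongr
          exact choose_mul_div_pow_le (by omega) _
      _ = (Real.exp 1 ^ 2 / 256) ^ (r + 1) := by rw [div_pow]; ring
      _ ≤ (1 / 4) ^ (r + 1) := by gcongr
  have hgeom : ∀ n : ℕ, ∑ r ∈ Finset.range n, (1 / 4 : ℝ) ^ (r + 1) = (1 - (1 / 4) ^ n) / 3 := by
    intro n
    induction n with
    | zero => simp
    | succ n ih => rw [Finset.sum_range_succ, ih]; ring
  refine (measureReal_mono hcover (measure_ne_top _ _)).trans ((measureReal_biUnion_finset_le _ _).trans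
    ((Finset.sum_le_sum hterm).trans ?_))
  rw [hgeom]
  have : (0 : ℝ) ≤ (1 / 4) ^ m := by positivity
  linarith

end Correlation

/-! ### Elementary inequalities for truncated powers. -/

section Truncation

lemma Real.rpow_sub_rpow_le_mul_sub {q x y : ℝ} (hq : 1 ≤ q) (hx : 0 ≤ x) (hxy : x ≤ y) :
    y ^ q - x ^ q ≤ q * y ^ (q - 1) * (y - x) := by
  rcases (hx.trans hxy).eq_or_lt with rfl | hy
  · simp [le_antisymm hxy hx]
  -- Bernoulli's inequality at x/y.
  have h := one_add_mul_self_le_rpow_one_add (s := x / y - 1)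
    (by have : 0 ≤ x / y := by positivity
        linarith) hq
  rw [show 1 + (x / y - 1) = x / y by ring, Real.div_rpow hx hy.le,
    le_div_iff₀ (by positivity)] at h
  rw [Real.rpow_sub_one hy.ne']
  have e : q * (y ^ q / y) * (y - x) = q * y ^ q - q * (x / y) * y ^ q := by field_simp
  rw [e]
  linarith

lemma abs_min_rpow_sub_min_rpow_le {q M s s' : ℝ} (hq : 1 ≤ q) (hM : 0 ≤ M) (hs : 0 ≤ s)
    (hs' : 0 ≤ s') : |min s M ^ q - min s' M ^ q| ≤ q * M ^ (q - 1) * |s - s'| := by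
  wlog h : s' ≤ s generalizing s s'
  · rw [abs_sub_comm, abs_sub_comm s]
    exact this hs' hs (le_of_not_ge h)
  have hmin : min s' M ≤ min s M := min_le_min_right M h
  have h0 : 0 ≤ min s' M := le_min hs' hM
  have h1 : min s' M ^ q ≤ min s M ^ q := by gcongr
  rw [abs_of_nonneg (by linarith), abs_of_nonneg (by linarith)]
  refine (Real.rpow_sub_rpow_le_mul_sub hq h0 hmin).trans ?_
  have h2 : min s M ^ (q - 1) ≤ M ^ (q - 1) :=
    Real.rpow_le_rpow (h0.trans hmin) (min_le_right _ _) (by linarith)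
  have h3 : min s M - min s' M ≤ s - s' := by
    rcases le_total s' M with h4 | h4
    · rw [min_eq_left h4]; linarith [min_le_left s M]
    · rw [min_eq_right h4]; linarith [min_le_right s M]
  gcongr

lemma rpow_sub_min_rpow_le {q M s : ℝ} (hq : 0 < q) (hM : 0 < M) (hs : 0 ≤ s) :
    s ^ q - min s M ^ q ≤ s ^ (4 * q) / M ^ (3 * q) := by
  rcases le_total s M with h | h
  · rw [min_eq_left h, sub_self]; positivity
  · have hM0 : 0 ≤ min s M ^ q := by positivity
    have : s ^ (4 * q) = s ^ q * s ^ (3 * q) := by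
      rw [← Real.rpow_add (by linarith)]; ring_nf
    have h2 : M ^ (3 * q) ≤ s ^ (3 * q) := by gcongr
    have h3 : s ^ q ≤ s ^ (4 * q) / M ^ (3 * q) := by
      rw [le_div_iff₀ (by positivity), this]; gcongr
    linarith

end Truncation

/-! ### A grid net in the unit ball. -/

section Grid

/-- The unit ball of an `n`-dimensional space has an `n / D`-net of cardinality at most
`(2 D + 1) ^ (2 n)`. -/
lemma exists_finset_net (𝕜 : Type*) [RCLike 𝕜] (n D : ℕ) (hD : 0 < D) :
    ∃ S : Finset (EuclideanSpace 𝕜 (Fin n)), S.card ≤ (2 * D + 1) ^ (2 * n) ∧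
      ∀ a : EuclideanSpace 𝕜 (Fin n), ‖a‖ ≤ 1 → ∃ b ∈ S, ‖a - b‖ ≤ n / D := by
  classical
  have hD0 : (0 : ℝ) < D := by exact_mod_cast hD
  let T : Finset (Fin n → ℤ × ℤ) := Fintype.piFinset fun _ =>
    Finset.Icc (-(D : ℤ)) D ×ˢ Finset.Icc (-(D : ℤ)) D
  let F : (Fin n → ℤ × ℤ) → EuclideanSpace 𝕜 (Fin n) := fun c => WithLp.toLp 2 fun i =>
    (((c i).1 / D : ℝ) : 𝕜) + (((c i).2 / D : ℝ) : 𝕜) * RCLike.I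
  have hround : ∀ x : ℝ, |x| ≤ 1 → round (D * x) ∈ Finset.Icc (-(D : ℤ)) D := by
    intro x hx
    have h1 := abs_le.mp (abs_sub_round (D * x))
    have h2 := abs_le.mp hx
    have h3 : (round (D * x) : ℝ) < D + 1 := by nlinarith
    have h4 : -(D + 1 : ℝ) < round (D * x) := by nlinarith
    have h3' : round (D * x) < (D : ℤ) + 1 := by exact_mod_cast h3
    have h4' : -((D : ℤ) + 1) < round (D * x) := by exact_mod_cast h4
    rw [Finset.mem_Icc]
    constructor <;> omega
  have herr : ∀ x : ℝ, |x - round (D * x) / D| ≤ 1 / (2 * D) := by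
    intro x
    have h1 := abs_sub_round (D * x)
    have : x - round (D * x) / D = (D * x - round (D * x)) / D := by field_simp
    rw [this, abs_div, abs_of_pos hD0, div_le_div_iff₀ hD0 (by positivity)]
    nlinarith
  refine ⟨T.image F, ?_, fun a ha => ?_⟩
  · refine Finset.card_image_le.trans (le_of_eq ?_)
    have : ((D : ℤ) + 1 - -D).toNat = 2 * D + 1 := by omega
    simp only [T, Fintype.card_piFinset, Finset.card_product, Int.card_Icc, this,
      Finset.prod_const, Finset.card_univ, Fintype.card_fin]
    rw [pow_mul, pow_two]
  · have hai : ∀ i, ‖a i‖ ≤ 1 := fun i => (PiLp.norm_apply_le a i).trans ha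
    have hI1 : ‖(RCLike.I : 𝕜)‖ ≤ 1 := by
      by_cases h : (RCLike.I : 𝕜) = 0
      · simp [h]
      · exact (RCLike.norm_I_of_ne_zero h).le
    let c : Fin n → ℤ × ℤ := fun i => (round (D * RCLike.re (a i)), round (D * RCLike.im (a i)))
    refine ⟨F c, Finset.mem_image_of_mem _ (Fintype.mem_piFinset.mpr fun i =>
      Finset.mem_product.mpr ⟨hround _ ((RCLike.abs_re_le_norm _).trans (hai i)),
        hround _ ((RCLike.abs_im_le_norm _).trans (hai i))⟩), ?_⟩
    have hcoord : ∀ i, ‖(a - F c) i‖ ≤ 1 / D := by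
      intro i
      have e : (a - F c) i = ((RCLike.re (a i) - round (D * RCLike.re (a i)) / D : ℝ) : 𝕜) +
          ((RCLike.im (a i) - round (D * RCLike.im (a i)) / D : ℝ) : 𝕜) * RCLike.I := by
        change a i - F c i = _
        conv_lhs => rw [← RCLike.re_add_im (a i)]
        simp only [F, c, RCLike.ofReal_sub]
        ring
      rw [e]
      refine (norm_add_le _ _).trans ?_
      rw [norm_mul, RCLike.norm_ofReal, RCLike.norm_ofReal]
      have h1 := herr (RCLike.re (a i))
      have h2 := (mul_le_of_le_one_right (abs_nonneg _) hI1).trans (herr (RCLike.im (a i)))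
      refine (add_le_add h1 h2).trans (le_of_eq ?_)
      field_simp
      norm_num
    have hsq : ‖a - F c‖ ^ 2 ≤ (n / D : ℝ) ^ 2 := by
      rw [EuclideanSpace.norm_sq_eq]
      calc ∑ i, ‖(a - F c) i‖ ^ 2 ≤ ∑ _i : Fin n, (1 / D : ℝ) ^ 2 := by
            gcongr with i; exact hcoord i
        _ = n * (1 / D : ℝ) ^ 2 := by simp
        _ ≤ (n : ℝ) ^ 2 * (1 / D : ℝ) ^ 2 := by
            gcongr
            exact_mod_cast Nat.le_self_pow two_ne_zero n
        _ = _ := by ring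
    exact (pow_le_pow_iff_left₀ (norm_nonneg _) (by positivity) two_ne_zero).mp hsq

end Grid

/-! ### Uniform approximation of moments by a random sample. -/

section MomentDiscretization

variable {Ω 𝕜 : Type*} [MeasurableSpace Ω] [RCLike 𝕜]

/-- The moments of the one-dimensional marginals of a bounded random vector are uniformly
approximated by the empirical moments, provided that the truncation level `M`, the mesh of the net
and the sample size satisfy the numerical conditions `htail`, `hexp`, `hlip` and `hnet`. -/
lemma exists_forall_abs_average_sub_integral_le {n m D : ℕ} {μ : Measure Ω}
    [IsProbabilityMeasure μ] {U : Ω → EuclideanSpace 𝕜 (Fin n)} (hU : StronglyMeasurable U)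
    {R : ℝ} (hR0 : 0 ≤ R) (hR : ∀ ω, ‖U ω‖ ≤ R) {B q : ℝ} (hB : 0 < B) (hq : 2 < q)
    (hmom : ∀ a, ∫ ω, ‖inner 𝕜 a (U ω)‖ ^ (4 * q) ∂μ ≤ (B * ‖a‖) ^ (4 * q))
    {E : Set Ω} (hE : μ E = 0) (hm : 0 < m) (hD : 0 < D) {M η : ℝ} (hM : 0 < M) (hη : 0 < η)
    (htail : 256 ^ (q / 2) * (R ^ q * ∑' r : ℕ, 1 / ((r + 1 : ℕ) : ℝ) ^ (q / 2) +
        2 * (2 * B) ^ q * √(m * (256 ^ (q / 2) * (R ^ q + (2 * B) ^ q * m) / M ^ q))) ≤ η * m)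
    (hexp : B ^ (4 * q) / M ^ (3 * q) ≤ η)
    (hlip : q * M ^ (q - 1) * (n / D * R) ≤ η)
    (hnet : ((2 * D + 1 : ℕ) : ℝ) ^ (2 * n) *
      (2 * Real.exp (-(2 * η ^ 2 / (M ^ q) ^ 2 * m))) < 1 / 2) :
    ∃ ξ : Fin m → Ω, (∀ j, ξ j ∉ E) ∧ ∀ a : EuclideanSpace 𝕜 (Fin n),
      |1 / (m : ℝ) * ∑ j, ‖inner 𝕜 a (U (ξ j))‖ ^ q - ∫ ω, ‖inner 𝕜 a (U ω)‖ ^ q ∂μ| ≤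
        5 * η * ‖a‖ ^ q := by
  have hq0 : 0 < q := by linarith
  have hm0 : (0 : ℝ) < m := by exact_mod_cast hm
  obtain ⟨S, hScard, hS⟩ := exists_finset_net 𝕜 n D hD
  let g : EuclideanSpace 𝕜 (Fin n) → Ω → ℝ := fun a ω => min ‖inner 𝕜 a (U ω)‖ M ^ q
  have hmeas : ∀ a : EuclideanSpace 𝕜 (Fin n), Measurable fun ω => ‖inner 𝕜 a (U ω)‖ :=
    fun a => (stronglyMeasurable_const.inner hU).norm.measurable
  have hg : ∀ a, Measurable (g a) := fun a => ((hmeas a).min measurable_const).pow_const q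
  have hgM : ∀ a ω, g a ω ∈ Set.Icc 0 (M ^ q) := fun a ω =>
    ⟨by positivity, by dsimp only [g]; gcongr; exact min_le_right _ _⟩
  have hgint : ∀ a, Integrable (g a) μ := fun a =>
    Integrable.of_mem_Icc 0 (M ^ q) (hg a).aemeasurable (ae_of_all _ (hgM a))
  have hpint : ∀ (a : EuclideanSpace 𝕜 (Fin n)) (r : ℝ), 0 < r →
      Integrable (fun ω => ‖inner 𝕜 a (U ω)‖ ^ r) μ := by
    intro a r hr
    refine Integrable.of_mem_Icc 0 ((‖a‖ * R) ^ r) ((hmeas a).pow_const _).aemeasurable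
      (ae_of_all _ fun ω => ⟨by positivity, ?_⟩)
    gcongr
    exact (norm_inner_le_norm _ _).trans (by gcongr; exact hR ω)
  set ν := Measure.pi fun _ : Fin m => μ
  let bad₀ : Set (Fin m → Ω) := ⋃ j, (fun x => x j) ⁻¹' E
  let bad₁ : Set (Fin m → Ω) := {x | ¬ WeaklyCorrelated 𝕜 (fun i => U (x i))
        (correlationRate (2 * B) q (Fintype.card (Fin m)))}
  let bad₂ : Set (Fin m → Ω) := ⋃ b ∈ S, {x | η ≤ |1 / (Fintype.card (Fin m) : ℝ) *
    ∑ j, g b (x j) - ∫ ω, g b ω ∂μ|}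
  have h0 : ν.real bad₀ = 0 := by
    rw [measureReal_eq_zero_iff, measure_iUnion_null_iff]
    exact fun j =>
      (measurePreserving_eval (fun _ : Fin m => μ) j).quasiMeasurePreserving.preimage_null hE
  have h1 : ν.real bad₁ ≤ 1 / 2 := measureReal_not_weaklyCorrelated_le hU hR hB hq hmom
  have h2 : ν.real bad₂ < 1 / 2 := by
    refine lt_of_le_of_lt ?_ hnet
    refine (measureReal_biUnion_finset_le _ _).trans ((Finset.sum_le_sum fun b _ =>
      measureReal_pi_abs_average_sub_ge_le μ (hg b) (T := M ^ q) (by positivity) (hgM b) hη.le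
        (by simpa using hm)).trans ?_)
    rw [Finset.sum_const, nsmul_eq_mul, Fintype.card_fin]
    gcongr
    exact_mod_cast hScard
  -- The bad events have probabilities 0, at most 1/2, and strictly less than 1/2.
  obtain ⟨ξ, hξ⟩ : ∃ ξ, ξ ∉ bad₀ ∪ (bad₁ ∪ bad₂) := by
    by_contra! hcon
    have huniv : bad₀ ∪ (bad₁ ∪ bad₂) = Set.univ := Set.eq_univ_of_forall hcon
    have : ν.real (bad₀ ∪ (bad₁ ∪ bad₂)) = 1 := by rw [huniv]; exact probReal_univ
    have h3 := measureReal_union_le (μ := ν) bad₀ (bad₁ ∪ bad₂)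
    have h4 := measureReal_union_le (μ := ν) bad₁ bad₂
    linarith
  simp only [Set.mem_union, not_or] at hξ
  obtain ⟨hξ0, hξ1, hξ2⟩ := hξ
  refine ⟨ξ, fun j hj => hξ0 (Set.mem_iUnion.mpr ⟨j, hj⟩), ?_⟩
  have hW : WeaklyCorrelated 𝕜 (fun i => U (ξ i))
      (correlationRate (2 * B) q (Fintype.card (Fin m))) := not_not.mp hξ1
  have hH : ∀ b ∈ S, |1 / (m : ℝ) * ∑ j, g b (ξ j) - ∫ ω, g b ω ∂μ| ≤ η := by
    intro b hb
    by_contra! hcon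
    refine hξ2 (Set.mem_iUnion₂.mpr ⟨b, hb, ?_⟩)
    simpa using hcon.le
  -- Five errors of size η: truncating the sample sum, moving to the net, Hoeffding there, moving
  -- back, and truncating the integral.
  have unit : ∀ a : EuclideanSpace 𝕜 (Fin n), ‖a‖ ≤ 1 →
      |1 / (m : ℝ) * ∑ j, ‖inner 𝕜 a (U (ξ j))‖ ^ q - ∫ ω, ‖inner 𝕜 a (U ω)‖ ^ q ∂μ| ≤
        5 * η := by
    intro a ha
    obtain ⟨b, hb, hab⟩ := hS a ha
    have hgle : ∀ ω, g a ω ≤ ‖inner 𝕜 a (U ω)‖ ^ q := fun ω => by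
      dsimp only [g]; gcongr; exact min_le_left _ _
    have e1 : |1 / (m : ℝ) * ∑ j, ‖inner 𝕜 a (U (ξ j))‖ ^ q - 1 / (m : ℝ) * ∑ j, g a (ξ j)| ≤
        η := by
      rw [← mul_sub, ← Finset.sum_sub_distrib, abs_of_nonneg (mul_nonneg (by positivity)
        (Finset.sum_nonneg fun j _ => sub_nonneg.mpr (hgle _)))]
      have key := hW.sum_filter_rpow_le hq (by positivity) hR0 (fun j => hR (ξ j)) ha hM
      rw [Fintype.card_fin] at key
      have hle : ∑ j, (‖inner 𝕜 a (U (ξ j))‖ ^ q - g a (ξ j)) ≤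
          ∑ j with M < ‖inner 𝕜 a (U (ξ j))‖, ‖inner 𝕜 a (U (ξ j))‖ ^ q := by
        rw [Finset.sum_filter]
        refine Finset.sum_le_sum fun j _ => ?_
        split_ifs with h
        · linarith [(hgM a (ξ j)).1]
        · simp only [g, min_eq_left (not_lt.mp h), sub_self, le_refl]
      rw [one_div, inv_mul_le_iff₀ hm0]
      linarith
    have hlipp : ∀ ω, |g a ω - g b ω| ≤ η := by
      intro ω
      refine (abs_min_rpow_sub_min_rpow_le (by linarith) hM.le (norm_nonneg _)
        (norm_nonneg _)).trans (le_trans ?_ hlip)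
      gcongr
      refine (abs_norm_sub_norm_le _ _).trans ?_
      rw [← inner_sub_left]
      refine (norm_inner_le_norm _ _).trans ?_
      gcongr
      exact hR ω
    have e2 : |1 / (m : ℝ) * ∑ j, g a (ξ j) - 1 / (m : ℝ) * ∑ j, g b (ξ j)| ≤ η := by
      rw [← mul_sub, ← Finset.sum_sub_distrib, abs_mul, abs_of_nonneg (by positivity), one_div,
        inv_mul_le_iff₀ hm0]
      refine (Finset.abs_sum_le_sum_abs _ _).trans
        ((Finset.sum_le_sum fun j _ => hlipp (ξ j)).trans (le_of_eq ?_))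
      simp
    have e3 := hH b hb
    have e4 : |∫ ω, g b ω ∂μ - ∫ ω, g a ω ∂μ| ≤ η := by
      rw [← integral_sub (hgint b) (hgint a)]
      have := norm_integral_le_of_norm_le_const (μ := μ) (f := fun ω => g b ω - g a ω) (C := η)
        (ae_of_all _ fun ω => by rw [Real.norm_eq_abs, abs_sub_comm]; exact hlipp ω)
      simpa using this
    have e5 : |∫ ω, g a ω ∂μ - ∫ ω, ‖inner 𝕜 a (U ω)‖ ^ q ∂μ| ≤ η := by
      rw [abs_sub_comm, ← integral_sub (hpint a q hq0) (hgint a),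
        abs_of_nonneg (integral_nonneg fun ω => sub_nonneg.mpr (hgle ω))]
      calc ∫ ω, (‖inner 𝕜 a (U ω)‖ ^ q - g a ω) ∂μ
          ≤ ∫ ω, ‖inner 𝕜 a (U ω)‖ ^ (4 * q) / M ^ (3 * q) ∂μ :=
            integral_mono ((hpint a q hq0).sub (hgint a))
              ((hpint a (4 * q) (by positivity)).div_const _)
              fun ω => rpow_sub_min_rpow_le hq0 hM (norm_nonneg _)
        _ = (∫ ω, ‖inner 𝕜 a (U ω)‖ ^ (4 * q) ∂μ) / M ^ (3 * q) := integral_div _ _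
        _ ≤ B ^ (4 * q) / M ^ (3 * q) := by
            gcongr
            refine (hmom a).trans ?_
            gcongr
            exact mul_le_of_le_one_right hB.le ha
        _ ≤ η := hexp
    rw [abs_le] at e1 e2 e3 e4 e5 ⊢
    constructor <;> linarith
  intro a
  rcases eq_or_ne a 0 with rfl | ha
  · simp [Real.zero_rpow hq0.ne']
  have ha0 : 0 < ‖a‖ := norm_pos_iff.mpr ha
  let u : EuclideanSpace 𝕜 (Fin n) := ((‖a‖⁻¹ : ℝ) : 𝕜) • a
  have hu : ‖u‖ ≤ 1 := by
    simp only [u, norm_smul, RCLike.norm_ofReal, abs_inv, abs_norm]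
    rw [inv_mul_cancel₀ ha0.ne']
  have hscale : ∀ ω, ‖inner 𝕜 a (U ω)‖ ^ q = ‖a‖ ^ q * ‖inner 𝕜 u (U ω)‖ ^ q := by
    intro ω
    rw [← Real.mul_rpow (norm_nonneg _) (norm_nonneg _), inner_smul_left, norm_mul,
      RCLike.norm_conj, RCLike.norm_ofReal, abs_inv, abs_norm, mul_inv_cancel_left₀ ha0.ne']
  simp only [hscale]
  rw [integral_const_mul, ← Finset.mul_sum, mul_left_comm, ← mul_sub, abs_mul,
    abs_of_nonneg (by positivity), mul_comm]
  gcongr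
  exact unit u hu

end MomentDiscretization

/-! ### Choice of the numerical constants. -/

section Constants

/-- M must not depend on m or N. Both quantities vanish as M → ∞; the second is the tail term
divided by m, once R^q ≤ m. -/
lemma exists_truncation_level {B q η : ℝ} (hq : 0 < q) (hη : 0 < η) :
    ∃ M : ℝ, 0 < M ∧ B ^ (4 * q) / M ^ (3 * q) ≤ η ∧
      256 ^ (q / 2) * (2 * (2 * B) ^ q *
        √(256 ^ (q / 2) * (1 + (2 * B) ^ q) / M ^ q)) ≤ η / 2 := by
  have h1 : Filter.Tendsto (fun M : ℝ => B ^ (4 * q) / M ^ (3 * q)) Filter.atTop (nhds 0) :=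
    (tendsto_rpow_atTop (by positivity)).const_div_atTop _
  have h2 : Filter.Tendsto (fun M : ℝ => 256 ^ (q / 2) * (2 * (2 * B) ^ q *
      √(256 ^ (q / 2) * (1 + (2 * B) ^ q) / M ^ q))) Filter.atTop (nhds 0) := by
    have h3 : Filter.Tendsto (fun M : ℝ => 256 ^ (q / 2) * (1 + (2 * B) ^ q) / M ^ q)
        Filter.atTop (nhds 0) := (tendsto_rpow_atTop hq).const_div_atTop _
    have h4 := ((Real.continuous_sqrt.tendsto _).comp h3).const_mul (2 * (2 * B) ^ q)
    have h5 := h4.const_mul ((256 : ℝ) ^ (q / 2))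
    simpa using h5
  obtain ⟨M, hM, hM1, hM2⟩ := ((Filter.eventually_gt_atTop 0).and
    ((h1.eventually_le_const hη).and (h2.eventually_le_const (half_pos hη)))).exists
  exact ⟨M, hM, hM1, hM2⟩

lemma mul_log_le_rpow {q : ℝ} (hq : 2 < q) {N : ℕ} (hN : 1 ≤ N) :
    (N : ℝ) * Real.log N ≤ 1 / (q / 2 - 1) * (N : ℝ) ^ (q / 2) := by
  have hN0 : (0 : ℝ) < N := by exact_mod_cast hN
  have hδ : 0 < q / 2 - 1 := by linarith
  calc (N : ℝ) * Real.log N ≤ N * ((N : ℝ) ^ (q / 2 - 1) / (q / 2 - 1)) := by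
        gcongr
        exact Real.log_le_rpow_div hN0.le hδ
    _ = 1 / (q / 2 - 1) * (N : ℝ) ^ (q / 2) := by
        rw [Real.rpow_sub_one hN0.ne']
        field_simp

/-- M is fixed first, then the mesh factor D₀, then C. The grid parameter D₀N² compensates n·R ≤
K·N^(3/2), and the resulting N log N in the net's log-cardinality is absorbed by N^(q/2). -/
lemma exists_constants {K B q η : ℝ} (hK : 0 < K) (hB : 0 < B) (hq : 2 < q) (hη : 0 < η) :
    ∃ C M : ℝ, ∃ D₀ : ℕ, 0 < C ∧ 0 < M ∧ 0 < D₀ ∧ B ^ (4 * q) / M ^ (3 * q) ≤ η ∧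
      ∀ N n m : ℕ, 1 ≤ N → n ≤ N → C * (N : ℝ) ^ (q / 2) ≤ m →
        256 ^ (q / 2) * ((K * √N) ^ q * ∑' r : ℕ, 1 / ((r + 1 : ℕ) : ℝ) ^ (q / 2) +
          2 * (2 * B) ^ q *
            √(m * (256 ^ (q / 2) * ((K * √N) ^ q + (2 * B) ^ q * m) / M ^ q))) ≤ η * m ∧
        q * M ^ (q - 1) * (n / ((D₀ * N ^ 2 : ℕ) : ℝ) * (K * √N)) ≤ η ∧
        ((2 * (D₀ * N ^ 2) + 1 : ℕ) : ℝ) ^ (2 * n) *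
          (2 * Real.exp (-(2 * η ^ 2 / (M ^ q) ^ 2 * m))) < 1 / 2 := by
  obtain ⟨M, hM, hM1, hM2⟩ := exists_truncation_level (B := B) (q := q) (by linarith) hη
  set Z := ∑' r : ℕ, 1 / ((r + 1 : ℕ) : ℝ) ^ (q / 2)
  have hZ : 0 ≤ Z := tsum_nonneg fun r => by positivity
  set A : ℝ := 256 ^ (q / 2)
  have hA : 0 < A := by positivity
  set D₀ : ℕ := ⌈q * M ^ (q - 1) * K / η⌉₊ + 1
  set κ := 2 * η ^ 2 / (M ^ q) ^ 2
  have hκ : 0 < κ := by positivity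
  set G := 2 * Real.log (3 * D₀) + 4 * (1 / (q / 2 - 1))
  -- In order: R^q ≤ m; the R^q part of the tail is at most ηm/2; the net's log-cardinality is at
  -- most κm/2; and κm/2 ≥ 2, so that 2e^(-2) < 1/2 finishes.
  set C := max (max (K ^ q) (K ^ q * (2 * A * Z / η))) (max (2 * G / κ) (4 / κ))
  have hC1 : K ^ q ≤ C := (le_max_left _ _).trans (le_max_left _ _)
  have hC2 : K ^ q * (2 * A * Z / η) ≤ C := (le_max_right _ _).trans (le_max_left _ _)
  have hC3 : 2 * G / κ ≤ C := (le_max_left _ _).trans (le_max_right _ _)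
  have hC4 : 4 / κ ≤ C := (le_max_right _ _).trans (le_max_right _ _)
  have hKq : 0 < K ^ q := by positivity
  have hC0 : 0 < C := hKq.trans_le hC1
  refine ⟨C, M, D₀, hC0, hM, Nat.succ_pos _, hM1, fun N n m hN hn hm => ?_⟩
  have hN1 : (1 : ℝ) ≤ N := by exact_mod_cast hN
  have hN0 : (0 : ℝ) < N := by linarith
  have hnN : (n : ℝ) ≤ N := by exact_mod_cast hn
  set Y := (N : ℝ) ^ (q / 2)
  have hY1 : 1 ≤ Y := Real.one_le_rpow hN1 (by linarith)
  have hNY : (N : ℝ) ≤ Y := by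
    calc (N : ℝ) = (N : ℝ) ^ (1 : ℝ) := (Real.rpow_one _).symm
      _ ≤ Y := Real.rpow_le_rpow_of_exponent_le hN1 (by linarith)
  have hCm : C ≤ m := (le_mul_of_one_le_right hC0.le hY1).trans hm
  have hm0 : (0 : ℝ) < m := hC0.trans_le hCm
  have hRq : (K * √N) ^ q = K ^ q * Y := by
    rw [Real.mul_rpow hK.le (Real.sqrt_nonneg _), Real.sqrt_eq_rpow, ← Real.rpow_mul hN0.le]
    congr 2
    ring
  refine ⟨?_, ?_, ?_⟩
  · rw [hRq]
    have h1 : K ^ q * Y ≤ m := le_trans (by gcongr) hm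
    have h2 : A * (K ^ q * Y * Z) ≤ η / 2 * m := by
      have h3 : K ^ q * (2 * A * Z / η) * Y ≤ m := le_trans (by gcongr) hm
      have h4 : A * (K ^ q * Y * Z) = η / 2 * (K ^ q * (2 * A * Z / η) * Y) := by field_simp
      rw [h4]
      gcongr
    have h3 : √(m * (A * (K ^ q * Y + (2 * B) ^ q * m) / M ^ q)) ≤
        m * √(A * (1 + (2 * B) ^ q) / M ^ q) := by
      rw [← Real.sqrt_sq hm0.le, ← Real.sqrt_mul (by positivity), Real.sqrt_sq hm0.le]
      apply Real.sqrt_le_sqrt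
      calc m * (A * (K ^ q * Y + (2 * B) ^ q * m) / M ^ q)
          ≤ m * (A * (m + (2 * B) ^ q * m) / M ^ q) := by gcongr
        _ = m ^ 2 * (A * (1 + (2 * B) ^ q) / M ^ q) := by ring
    have h4 : A * (2 * (2 * B) ^ q * √(m * (A * (K ^ q * Y + (2 * B) ^ q * m) / M ^ q))) ≤
        η / 2 * m := by
      calc _ ≤ A * (2 * (2 * B) ^ q * (m * √(A * (1 + (2 * B) ^ q) / M ^ q))) := by gcongr
        _ = A * (2 * (2 * B) ^ q * √(A * (1 + (2 * B) ^ q) / M ^ q)) * m := by ring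
        _ ≤ _ := by gcongr
    rw [mul_add]
    linarith
  · have hD : q * M ^ (q - 1) * K / η ≤ D₀ :=
      (Nat.le_ceil _).trans (by exact_mod_cast Nat.le_succ _)
    have hD0 : (0 : ℝ) < D₀ := by exact_mod_cast Nat.succ_pos _
    have hsq : √(N : ℝ) ≤ N := by
      rw [Real.sqrt_le_left hN0.le]; nlinarith
    rw [div_le_iff₀ hη] at hD
    push_cast
    calc q * M ^ (q - 1) * (n / (D₀ * (N : ℝ) ^ 2) * (K * √N))
        ≤ q * M ^ (q - 1) * (N / (D₀ * (N : ℝ) ^ 2) * (K * N)) := by gcongr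
      _ = q * M ^ (q - 1) * K / D₀ := by field_simp
      _ ≤ η := by rw [div_le_iff₀ hD0]; linarith
  · have hD1 : (1 : ℝ) ≤ D₀ := by exact_mod_cast Nat.succ_pos _
    have hbase : ((2 * (D₀ * N ^ 2) + 1 : ℕ) : ℝ) ≤ 3 * D₀ * (N : ℝ) ^ 2 := by
      push_cast
      nlinarith [one_le_mul_of_one_le_of_one_le hD1 (one_le_pow₀ hN1 (n := 2))]
    have hX : (0 : ℝ) < 3 * D₀ * (N : ℝ) ^ 2 := by positivity
    have hpow : ((2 * (D₀ * N ^ 2) + 1 : ℕ) : ℝ) ^ (2 * n) ≤ Real.exp (G * Y) := by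
      calc ((2 * (D₀ * N ^ 2) + 1 : ℕ) : ℝ) ^ (2 * n)
          ≤ ((2 * (D₀ * N ^ 2) + 1 : ℕ) : ℝ) ^ (2 * N) := by
            gcongr
            exact_mod_cast Nat.succ_le_succ (Nat.zero_le _)
        _ ≤ (3 * D₀ * (N : ℝ) ^ 2) ^ (2 * N) := by gcongr
        _ = Real.exp (2 * Real.log (3 * D₀) * N + 4 * (N * Real.log N)) := by
            rw [← Real.exp_log (pow_pos hX _), Real.log_pow,
              Real.log_mul (by positivity) (by positivity), Real.log_pow]
            push_cast
            ring_nf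
        _ ≤ Real.exp (G * Y) := by
            apply Real.exp_le_exp.mpr
            have hlog : 0 ≤ Real.log (3 * D₀) := Real.log_nonneg (by linarith)
            have := mul_log_le_rpow hq hN
            have h2 : 2 * Real.log (3 * D₀) * N ≤ 2 * Real.log (3 * D₀) * Y := by gcongr
            change _ ≤ (2 * Real.log (3 * D₀) + 4 * (1 / (q / 2 - 1))) * Y
            linarith
    have hGY : G * Y ≤ κ / 2 * m := by
      have h3 : 2 * G / κ * Y ≤ m := le_trans (by gcongr) hm
      have h4 : G * Y = κ / 2 * (2 * G / κ * Y) := by field_simp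
      rw [h4]
      gcongr
    have hκm : 2 ≤ κ / 2 * m := by
      have h3 := hC4.trans hCm
      rw [div_le_iff₀ hκ] at h3
      linarith
    have hexp2 : Real.exp (-2) < 1 / 4 := by
      rw [Real.exp_neg, one_div]
      gcongr
      linarith [Real.quadratic_le_exp_of_nonneg (show (0 : ℝ) ≤ 2 by norm_num)]
    calc ((2 * (D₀ * N ^ 2) + 1 : ℕ) : ℝ) ^ (2 * n) * (2 * Real.exp (-(κ * m)))
        ≤ Real.exp (κ / 2 * m) * (2 * Real.exp (-(κ * m))) := by
          gcongr
          exact hpow.trans (Real.exp_le_exp.mpr hGY)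
      _ = 2 * Real.exp (-(κ / 2 * m)) := by
          rw [mul_left_comm, ← Real.exp_add]
          ring_nf
      _ ≤ 2 * Real.exp (-2) := by gcongr
      _ < 1 / 2 := by linarith

end Constants

/-! ### Function spaces as marginals of an isotropic random vector. -/

section Representation

variable {Ω 𝕜 : Type*} [MeasurableSpace Ω] [RCLike 𝕜]

/-- The linear map that sends a function of a subspace of `L_p` to its class. -/
noncomputable def Submodule.toLp {μ : Measure Ω} {p : ℝ≥0∞} (X : Submodule 𝕜 (Ω → 𝕜))
    (hX : ∀ f ∈ X, MemLp f p μ) : X →ₗ[𝕜] Lp 𝕜 p μ where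
  toFun f := (hX f.1 f.2).toLp f.1
  map_add' f g := MemLp.toLp_add (hX f.1 f.2) (hX g.1 g.2)
  map_smul' c f := MemLp.toLp_const_smul c (hX f.1 f.2)

/-- A finite-dimensional space of square-integrable functions is, up to a null set, the space of the
one-dimensional marginals `⟨a, U⟩` of an isotropic random vector `U`. -/
lemma exists_isotropic_representation {μ : Measure Ω} {N : ℕ} {X : Submodule 𝕜 (Ω → 𝕜)}
    (hX : IsLpSubspace μ 2 N X) :
    ∃ n ≤ N, ∃ U : Ω → EuclideanSpace 𝕜 (Fin n), StronglyMeasurable U ∧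
      (∃ E, μ E = 0 ∧ ∀ f ∈ X, ∃ a, ∀ ω ∉ E, f ω = inner 𝕜 a (U ω)) ∧
      (∀ a, ∃ f ∈ X, f =ᵐ[μ] fun ω => inner 𝕜 a (U ω)) ∧
      ∀ a, eLpNorm (fun ω => inner 𝕜 a (U ω)) 2 μ = ENNReal.ofReal ‖a‖ := by
  obtain ⟨u, hu⟩ := hX.exists_span
  have : FiniteDimensional 𝕜 X := by
    rw [hu]; exact FiniteDimensional.span_of_finite 𝕜 (Set.finite_range u)
  let T := X.toLp hX.memLp
  let e := stdOrthonormalBasis 𝕜 (LinearMap.range T)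
  set n := Module.finrank 𝕜 (LinearMap.range T)
  have hn : n ≤ N := by
    refine (LinearMap.finrank_range_le T).trans ?_
    have h := finrank_range_le_card (R := 𝕜) u
    rw [Set.finrank, ← hu, Fintype.card_fin] at h
    exact h
  let U : Ω → EuclideanSpace 𝕜 (Fin n) := fun ω =>
    WithLp.toLp 2 fun i => ((e i : LinearMap.range T) : Lp 𝕜 2 μ) ω
  have hU : StronglyMeasurable U :=
    (PiLp.continuous_toLp 2 _).comp_stronglyMeasurable
      (measurable_pi_lambda _ fun i => (Lp.stronglyMeasurable _).measurable).stronglyMeasurable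
  -- Conjugated coordinates, because the inner product is conjugate-linear in its first argument.
  let w : EuclideanSpace 𝕜 (Fin n) → LinearMap.range T := fun a =>
    e.repr.symm (WithLp.toLp 2 fun i => (starRingEnd 𝕜) (a i))
  have hwnorm : ∀ a, ‖w a‖ = ‖a‖ := by
    intro a
    simp only [w, LinearIsometryEquiv.norm_map, EuclideanSpace.norm_eq, RCLike.norm_conj]
  have hwcoe : ∀ a, ((w a : LinearMap.range T) : Lp 𝕜 2 μ) =ᵐ[μ] fun ω => inner 𝕜 a (U ω) := by
    intro a
    have h1 : ((w a : LinearMap.range T) : Lp 𝕜 2 μ) =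
        ∑ i, (starRingEnd 𝕜) (a i) • ((e i : LinearMap.range T) : Lp 𝕜 2 μ) := by
      simp only [w]
      rw [← e.sum_repr_symm]
      simp
    rw [h1]
    have h2 : ∀ᵐ ω ∂μ, ∀ i, ((starRingEnd 𝕜) (a i) • ((e i : LinearMap.range T) : Lp 𝕜 2 μ)
        : Lp 𝕜 2 μ) ω = (starRingEnd 𝕜) (a i) * ((e i : LinearMap.range T) : Lp 𝕜 2 μ) ω :=
      ae_all_iff.mpr fun i => Lp.coeFn_smul _ _
    filter_upwards [Lp.coeFn_fun_finsetSum Finset.univ fun i =>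
      (starRingEnd 𝕜) (a i) • ((e i : LinearMap.range T) : Lp 𝕜 2 μ), h2] with ω h3 h4
    rw [h3, PiLp.inner_apply]
    refine Finset.sum_congr rfl fun i _ => ?_
    rw [h4 i, RCLike.inner_apply, mul_comm]
  have hrep : ∀ f : X, ∃ a, (f : Ω → 𝕜) =ᵐ[μ] fun ω => inner 𝕜 a (U ω) := by
    intro f
    let y : LinearMap.range T := ⟨T f, LinearMap.mem_range_self T f⟩
    refine ⟨WithLp.toLp 2 fun i => (starRingEnd 𝕜) (e.repr y i), ?_⟩
    have hy : w (WithLp.toLp 2 fun i => (starRingEnd 𝕜) (e.repr y i)) = y := by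
      simp only [w, RCLike.conj_conj]
      exact e.repr.symm_apply_apply y
    have h1 := hwcoe (WithLp.toLp 2 fun i => (starRingEnd 𝕜) (e.repr y i))
    rw [hy] at h1
    exact ((hX.memLp f.1 f.2).coeFn_toLp).symm.trans h1
  have huX : ∀ k, u k ∈ X := fun k => by
    rw [hu]; exact Submodule.subset_span (Set.mem_range_self k)
  -- Only the finitely many spanning functions need exceptional sets: off their union the
  -- representation extends by linearity, so one null set serves all of X.
  choose a ha using fun k : Fin N => hrep ⟨u k, huX k⟩
  refine ⟨n, hn, U, hU, ⟨⋃ k, {ω | ¬ u k ω = inner 𝕜 (a k) (U ω)}, ?_, fun f hf => ?_⟩,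
    fun b => ?_, fun b => ?_⟩
  · exact measure_iUnion_null_iff.mpr fun k => ha k
  · rw [hu] at hf
    induction hf using Submodule.span_induction with
    | mem f hf =>
      obtain ⟨k, rfl⟩ := hf
      refine ⟨a k, fun ω hω => ?_⟩
      simp only [Set.mem_iUnion, Set.mem_ofPred_eq, not_exists, not_not] at hω
      exact hω k
    | zero => exact ⟨0, fun ω _ => by simp⟩
    | add f g _ _ hf hg =>
      obtain ⟨b, hb⟩ := hf
      obtain ⟨c, hc⟩ := hg
      exact ⟨b + c, fun ω hω => by rw [Pi.add_apply, hb ω hω, hc ω hω, inner_add_left]⟩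
    | smul c f _ hf =>
      obtain ⟨b, hb⟩ := hf
      exact ⟨(starRingEnd 𝕜) c • b, fun ω hω => by
        rw [Pi.smul_apply, hb ω hω, inner_smul_left, RCLike.conj_conj, smul_eq_mul]⟩
  · obtain ⟨f, hf⟩ := (w b).2
    refine ⟨f.1, f.2, ((hX.memLp f.1 f.2).coeFn_toLp).symm.trans ?_⟩
    have h := hwcoe b
    rw [← hf] at h
    exact h
  · rw [← eLpNorm_congr_ae (hwcoe b), ← hwnorm b, Submodule.coe_norm, Lp.norm_def,
      ENNReal.ofReal_toReal (Lp.eLpNorm_ne_top _)]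

/-- A random vector all of whose marginals are essentially bounded is essentially bounded. -/
lemma ae_norm_le_of_forall_ae_norm_inner_le {V : Type*} [NormedAddCommGroup V]
    [InnerProductSpace 𝕜 V] [TopologicalSpace.SeparableSpace V] {μ : Measure Ω} {U : Ω → V}
    {R : ℝ} (hR : 0 ≤ R) (h : ∀ a, ∀ᵐ ω ∂μ, ‖inner 𝕜 a (U ω)‖ ≤ R * ‖a‖) :
    ∀ᵐ ω ∂μ, ‖U ω‖ ≤ R := by
  have h1 : ∀ᵐ ω ∂μ, ∀ k : ℕ, ‖inner 𝕜 (TopologicalSpace.denseSeq V k) (U ω)‖ ≤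
      R * ‖TopologicalSpace.denseSeq V k‖ := ae_all_iff.mpr fun k => h _
  filter_upwards [h1] with ω hω
  have h2 : ∀ a : V, ‖inner 𝕜 a (U ω)‖ ≤ R * ‖a‖ := by
    intro a
    have hclosed : IsClosed {a : V | ‖inner 𝕜 a (U ω)‖ ≤ R * ‖a‖} :=
      isClosed_le (by fun_prop) (by fun_prop)
    exact hclosed.closure_subset_iff.mpr (by rintro _ ⟨k, rfl⟩; exact hω k)
      (TopologicalSpace.denseRange_denseSeq V a)
  -- Density gave one null set for all directions, so the direction may depend on ω.
  have h3 := h2 (U ω)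
  rw [inner_self_eq_norm_sq_to_K, norm_pow, RCLike.norm_ofReal, abs_norm, sq] at h3
  rcases (norm_nonneg (U ω)).eq_or_lt with h0 | h0
  · rwa [← h0]
  · exact le_of_mul_le_mul_right h3 h0

end Representation

/-! ### The discretization theorem. -/

theorem mainTheorem2 (t B q ε : ℝ) (hB : 0 < B) (hq : 2 < q) (hε₀ : 0 < ε) (hε₁ : ε < 1) :
    ∃ C : ℝ, 0 < C ∧
      ∀ (𝕜 : Type*) [RCLike 𝕜] (Ω : Type*) [MeasurableSpace Ω] (μ : Measure Ω)
        [IsProbabilityMeasure μ] (E : Set Ω), μ E = 0 →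
      ∀ (N : ℕ) (X : Submodule 𝕜 (Ω → 𝕜)),
        IsLpSubspace μ (ENNReal.ofReal q) N X →
        NikolskiiTwoInfty μ t N X →
        (∀ f ∈ X, eLpNorm f (ENNReal.ofReal (4 * q)) μ ≤ ENNReal.ofReal B * eLpNorm f 2 μ) →
      ∀ m : ℕ, 1 ≤ m → C * (N : ℝ) ^ (q / 2) ≤ (m : ℝ) →
        MarcinkiewiczEps μ E m q ε X := by
  have hq0 : 0 < q := by linarith
  -- |t| + 1 is positive whatever the sign of t, and ε/5 leaves room for the five errors.
  obtain ⟨C, M, D₀, hC, hM, hD₀, hexp, hconst⟩ := exists_constants (K := |t| + 1) (B := B)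
    (η := ε / 5) (by positivity) hB hq (by positivity)
  refine ⟨C, hC, fun 𝕜 _ Ω _ μ _ E hE N X hX ht hBX m hm hmN => ?_⟩
  rcases Nat.eq_zero_or_pos N with rfl | hN
  · obtain ⟨ω, hω⟩ : ∃ ω, ω ∉ E := by
      by_contra! hcon
      rw [Set.eq_univ_of_forall hcon, measure_univ] at hE
      exact one_ne_zero hE
    refine ⟨fun _ => ω, fun _ => hω, fun f hf => ?_⟩
    obtain ⟨u, hu⟩ := hX.exists_span
    have hf0 : f = 0 := by
      rw [hu, Set.range_eq_empty, Submodule.span_empty] at hf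
      exact (Submodule.mem_bot 𝕜).mp hf
    simp [hf0, Real.zero_rpow hq0.ne']
  set R := (|t| + 1) * √(N : ℝ)
  have hR0 : 0 ≤ R := by positivity
  have h2q : (2 : ℝ≥0∞) ≤ ENNReal.ofReal q := by
    rw [show (2 : ℝ≥0∞) = ENNReal.ofReal 2 by simp]
    exact ENNReal.ofReal_le_ofReal hq.le
  have hX2 : IsLpSubspace μ 2 N X := ⟨hX.exists_span, fun f hf => (hX.memLp f hf).mono_exponent h2q⟩
  obtain ⟨n, hn, U₀, hU₀, ⟨E₀, hE₀, hrep₀⟩, hmem, hnorm⟩ := exists_isotropic_representation hX2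
  have hbound : ∀ᵐ ω ∂μ, ‖U₀ ω‖ ≤ R := by
    refine ae_norm_le_of_forall_ae_norm_inner_le (𝕜 := 𝕜) hR0 fun a => ?_
    obtain ⟨f, hf, hfa⟩ := hmem a
    have h1 := ht f hf
    rw [eLpNorm_congr_ae hfa, eLpNorm_congr_ae hfa, hnorm a, eLpNorm_exponent_top] at h1
    filter_upwards [ae_le_eLpNormEssSup (μ := μ) (f := fun ω => inner 𝕜 a (U₀ ω))] with ω hω
    have h2 := hω.trans h1
    rw [← ENNReal.ofReal_mul' (norm_nonneg _), ← ofReal_norm] at h2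
    refine (ENNReal.ofReal_le_ofReal_iff (by positivity)).mp (h2.trans
      (ENNReal.ofReal_le_ofReal ?_))
    simp only [R]
    gcongr
    linarith [le_abs_self t]
  classical
  -- Redefined on a null set so that the norm bound holds at every point, as the greedy argument
  -- needs.
  let U : Ω → EuclideanSpace 𝕜 (Fin n) := fun ω => if ‖U₀ ω‖ ≤ R then U₀ ω else 0
  have hU : StronglyMeasurable U :=
    hU₀.ite (measurableSet_le hU₀.norm.measurable measurable_const) stronglyMeasurable_const
  have hUae : ∀ᵐ ω ∂μ, U₀ ω = U ω := by
    filter_upwards [hbound] with ω hω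
    simp only [U, if_pos hω]
  have hUR : ∀ ω, ‖U ω‖ ≤ R := by
    intro ω
    simp only [U]
    split_ifs with h
    · exact h
    · simpa using hR0
  have hinner : ∀ a, (fun ω => inner 𝕜 a (U₀ ω)) =ᵐ[μ] fun ω => inner 𝕜 a (U ω) := by
    intro a
    filter_upwards [hUae] with ω hω
    rw [hω]
  have hmemLp : ∀ (a : EuclideanSpace 𝕜 (Fin n)) (p : ℝ≥0∞),
      MemLp (fun ω => (inner 𝕜 a (U ω) : 𝕜)) p μ := fun a p =>
    MemLp.of_bound (stronglyMeasurable_const.inner hU).aestronglyMeasurable (‖a‖ * R)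
      (ae_of_all _ fun ω => (norm_inner_le_norm _ _).trans (by gcongr; exact hUR ω))
  have hpow : ∀ (a : EuclideanSpace 𝕜 (Fin n)) (r : ℝ), 0 < r →
      eLpNorm (fun ω => (inner 𝕜 a (U ω) : 𝕜)) (ENNReal.ofReal r) μ =
        ENNReal.ofReal ((∫ ω, ‖inner 𝕜 a (U ω)‖ ^ r ∂μ) ^ r⁻¹) := by
    intro a r hr
    rw [(hmemLp a _).eLpNorm_eq_integral_rpow_norm (by simpa using hr) ENNReal.ofReal_ne_top,
      ENNReal.toReal_ofReal hr.le]
  have hmom : ∀ a, ∫ ω, ‖inner 𝕜 a (U ω)‖ ^ (4 * q) ∂μ ≤ (B * ‖a‖) ^ (4 * q) := by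
    intro a
    obtain ⟨f, hf, hfa⟩ := hmem a
    have h1 := hBX f hf
    rw [eLpNorm_congr_ae hfa, eLpNorm_congr_ae hfa, hnorm a, eLpNorm_congr_ae (hinner a),
      hpow a _ (by positivity), ← ENNReal.ofReal_mul hB.le,
      ENNReal.ofReal_le_ofReal_iff (by positivity)] at h1
    exact (Real.rpow_inv_le_iff_of_pos (integral_nonneg fun ω => by positivity) (by positivity)
      (by positivity)).mp h1
  -- By isotropy ‖a‖ is the L_2 norm, which the L_q norm dominates on a probability space; this
  -- turns the absolute error into a relative one.
  have hlower : ∀ a, ‖a‖ ^ q ≤ ∫ ω, ‖inner 𝕜 a (U ω)‖ ^ q ∂μ := by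
    intro a
    have h1 := eLpNorm_le_eLpNorm_of_exponent_le h2q (hmemLp a 2).aestronglyMeasurable
    rw [← eLpNorm_congr_ae (hinner a), hnorm a, hpow a _ hq0,
      ENNReal.ofReal_le_ofReal_iff (Real.rpow_nonneg (integral_nonneg fun ω => by positivity) _)]
      at h1
    exact (Real.le_rpow_inv_iff_of_pos (norm_nonneg _) (integral_nonneg fun ω => by positivity)
      hq0).mp h1
  obtain ⟨htail, hlip, hnet⟩ := hconst N n m hN hn hmN
  have hnull : μ (E ∪ (E₀ ∪ {ω | ¬ U₀ ω = U ω})) = 0 :=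
    measure_union_null hE (measure_union_null hE₀ hUae)
  obtain ⟨ξ, hξ, hdisc⟩ := exists_forall_abs_average_sub_integral_le hU hR0 hUR hB hq hmom hnull
    (by omega) (Nat.mul_pos hD₀ (pow_pos hN 2)) hM (by positivity) htail hexp hlip hnet
  refine ⟨ξ, fun j hj => hξ j (Or.inl hj), fun f hf => ?_⟩
  obtain ⟨a, ha⟩ := hrep₀ f hf
  have hfU : ∀ ω ∉ E ∪ (E₀ ∪ {ω | ¬ U₀ ω = U ω}), f ω = inner 𝕜 a (U ω) := by
    intro ω hω
    simp only [Set.mem_union, Set.mem_ofPred_eq, not_or, not_not] at hω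
    rw [ha ω hω.2.1, hω.2.2]
  have hint : ∫ ω, ‖f ω‖ ^ q ∂μ = ∫ ω, ‖inner 𝕜 a (U ω)‖ ^ q ∂μ := by
    refine integral_congr_ae ?_
    filter_upwards [measure_eq_zero_iff_ae_notMem.mp hnull] with ω hω
    rw [hfU ω hω]
  have hsum : ∑ j, ‖f (ξ j)‖ ^ q = ∑ j, ‖inner 𝕜 a (U (ξ j))‖ ^ q :=
    Finset.sum_congr rfl fun j _ => by rw [hfU _ (hξ j)]
  have h1 := abs_le.mp (hdisc a)
  have h2 : 5 * (ε / 5) * ‖a‖ ^ q ≤ ε * ∫ ω, ‖inner 𝕜 a (U ω)‖ ^ q ∂μ := by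
    rw [mul_div_cancel₀ ε (by norm_num : (5 : ℝ) ≠ 0)]
    exact mul_le_mul_of_nonneg_left (hlower a) hε₀.le
  rw [hint, hsum]
  constructor <;> linarith
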